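/- For words $u,v$ over a finite alphabet $\Sigma$ let $\binom{u}{v}$ be the number of occurrences of $v$ as a scattered factor of $u$, that is, the number of sequences $i_1<\dots<i_{|v|}$ of positions of $u$ with $u[i_1]\cdots u[i_{|v|}]=v$. Words $u,u'\in\Sigma^*$ are $k$-binomial equivalent, $u\equiv_k u'$, if $\binom{u}{y}=\binom{u'}{y}$ for all words $y\in\Sigma^*$ of length at most $k$. Theorem. There is a deterministic algorithm which, given two words $w$ and $x$ over a finite alphabet and a number $k\in\mathbb{N}$, finds all the factors of $w$ that are $k$-binomial equivalent to $x$ in polynomial time. Precisely: it outputs, without repetition, exactly the pairs $(i,\ell)$ with $i,\ell\ge 0$ and $i+\ell\le |w|$ such that $w[i+1..i+\ell]\equiv_k x$. The time is measured on the unit-cost RAM with logarithmic word size: for an input of size $N$ (one memory cell for each letter of $w$ and $x$ and for each binary digit of $k$, and one cell for the length of each of the three parts) the machine words have $W\ge C\log_2 N$ bits for a suitable constant $C>0$, the letters of the alphabet are given as distinct machine words, and every arithmetic (addition, subtraction, multiplication, division, remainder, shift, bitwise, comparison), data movement (including indirect addressing) and control instruction costs one step. The program, the constant $C$ and the polynomial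 in $N$ that bounds the number of steps depend neither on the alphabet nor on $w$, $x$, $k$, $W$. -/

import Mathlib

/-! ### Binomial coefficients of words and `k`-binomial equivalence -/

/-- The binomial coefficient of the words `u` and `v`: the number of occurrences of `v` as a
scattered factor of `u`. (`List.sublists u` has one entry for each set of positions of `u`, namely
the word read off at these positions in increasing order, so `v` is counted with multiplicity.) -/
def wordBinom {A : Type} [DecidableEq A] (u v : List A) : ℕ :=
  u.sublists.count v

/-- `u` and `v` are `k`-binomial equivalent. -/
def BinomEquiv {A : Type} [DecidableEq A] (k : ℕ) (u v : List A) : Prop :=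
  ∀ y : List A, y.length ≤ k → wordBinom u y = wordBinom v y

/-- The pair `(i, l)` is an occurrence in `w` of a factor that is `k`-binomial equivalent to `x`:
the factor of `w` of length `l` that follows the first `i` letters lies inside `w` and is
equivalent to `x`. -/
def IsBinomMatch {A : Type} [DecidableEq A] (w x : List A) (k : ℕ) (q : ℕ × ℕ) : Prop :=
  q.1 + q.2 ≤ w.length ∧ BinomEquiv k ((w.drop q.1).take q.2) x

/-! ### The unit-cost RAM with bounded machine words -/

namespace WordRAM

/-- Binary operations of the machine. -/
inductive BinOp where
  | add | sub | mul | div | rem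
  | band | bor | bxor | shl | shr
  | eq | lt

/-- Value of a binary operation on machine words of `W` bits, before truncation to `W` bits.
Subtraction is modulo `2 ^ W`; the comparisons return `0` or `1`. -/
def BinOp.eval (W : ℕ) : BinOp → ℕ → ℕ → ℕ
  | add, a, b => a + b
  | sub, a, b => a + (2 ^ W - b % 2 ^ W)
  | mul, a, b => a * b
  | div, a, b => a / b
  | rem, a, b => a % b
  | band, a, b => a &&& b
  | bor, a, b => a ||| b
  | bxor, a, b => a ^^^ b
  | shl, a, b => a * 2 ^ b
  | shr, a, b => a / 2 ^ b
  | eq, a, b => if a = b then 1 else 0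
  | lt, a, b => if a < b then 1 else 0

/-- Instructions. The numbers `d`, `a`, `b` name registers, `l` is a position in the program. -/
inductive Instr where
  /-- `r_d := c` -/
  | const (d c : ℕ)
  /-- `r_d := r_a` -/
  | copy (d a : ℕ)
  /-- `r_d := r_a o r_b` -/
  | op (o : BinOp) (d a b : ℕ)
  /-- `r_d := mem[r_a]` -/
  | load (d a : ℕ)
  /-- `mem[r_a] := r_b` -/
  | store (a b : ℕ)
  /-- unconditional branch -/
  | jump (l : ℕ)
  /-- branch if `r_a = 0` -/
  | jumpZero (a l : ℕ)
  /-- subroutine call: the return position is kept in `r_d` -/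
  | call (d l : ℕ)
  /-- return from a subroutine to the position kept in `r_a` -/
  | ret (a : ℕ)

/-- A program is a finite list of instructions; it mentions only finitely many registers. -/
abbrev Program := List Instr

/-- A configuration: program counter, registers, memory. -/
structure Config where
  pc : ℕ
  reg : ℕ → ℕ
  mem : ℕ → ℕ

/-- Write the `W` low-order bits of `v` into the register `d`, and go to the next instruction. -/
def Config.setReg (W : ℕ) (c : Config) (d v : ℕ) : Config :=
  { pc := c.pc + 1, reg := Function.update c.reg d (v % 2 ^ W), mem := c.mem }

/-- Execution of one instruction on a machine with words of `W` bits. -/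
def Instr.exec (W : ℕ) (c : Config) : Instr → Config
  | const d v => c.setReg W d v
  | copy d a => c.setReg W d (c.reg a)
  | op o d a b => c.setReg W d (o.eval W (c.reg a) (c.reg b))
  | load d a => c.setReg W d (c.mem (c.reg a))
  | store a b =>
      { pc := c.pc + 1, reg := c.reg, mem := Function.update c.mem (c.reg a) (c.reg b) }
  | jump l => { c with pc := l }
  | jumpZero a l => { c with pc := if c.reg a = 0 then l else c.pc + 1 }
  | call d l => { c.setReg W d (c.pc + 1) with pc := l }
  | ret a => { c with pc := c.reg a }

/-- The machine has halted when the program counter has left the program. -/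
def Halted (P : Program) (c : Config) : Prop := P.length ≤ c.pc

/-- One step: execute the current instruction; a halted machine does not move. -/
def step (W : ℕ) (P : Program) (c : Config) : Config :=
  match P[c.pc]? with
  | some I => I.exec W c
  | none => c

/-- Initial configuration: the input occupies the first memory cells, all else is zero. -/
def init (input : List ℕ) : Config :=
  { pc := 0, reg := fun _ => 0, mem := fun i => input.getD i 0 }

/-- The list `out` is the output of the configuration `c`: it stands in consecutive memory cells,
from the address in register `0` on, and its length is in register `1`. -/
def Outputs (W : ℕ) (c : Config) (out : List ℕ) : Prop :=
  c.reg 1 = out.length ∧ c.reg 0 + out.length ≤ 2 ^ W ∧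
    ∀ (i : ℕ) (h : i < out.length), c.mem (c.reg 0 + i) = out[i]

/-- With words of `W` bits, the program `P` halts on `input` after at most `T` instructions, with
output `out`. -/
def ComputesWithin (W : ℕ) (P : Program) (input : List ℕ) (T : ℕ) (out : List ℕ) : Prop :=
  ∃ t ≤ T, Halted P ((step W P)^[t] (init input)) ∧ Outputs W ((step W P)^[t] (init input)) out

end WordRAM

/-! ### Input and output format of the matching problem -/

/-- The input `(w, x, k)`, laid out in memory cells: each of the three parts is preceded by its
length, a letter `a` takes the one cell `code a`, and `k` is written in binary, one bit per cell,
least significant bit first. -/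
def matchInput {A : Type} (code : A → ℕ) (w x : List A) (k : ℕ) : List ℕ :=
  (w.length :: w.map code) ++ (x.length :: x.map code) ++
    ((Nat.digits 2 k).length :: Nat.digits 2 k)

/-- A list of pairs, laid out in memory cells. -/
def pairsOutput (L : List (ℕ × ℕ)) : List ℕ :=
  L.flatMap fun q => [q.1, q.2]

/-! ### A structured language with bounded loops, compiled to the machine -/

namespace WordRAM

/-- A state of the structured language: the values of the variables, and a memory whose cells are
addressed by a row and a column. -/
structure St (V : Type) where
  var : V → ℕ
  mem : ℕ → ℕ → ℕ

variable {V : Type} [DecidableEq V]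

/-- Assign the value `a` to the variable `x`. -/
def St.set (σ : St V) (x : V) (a : ℕ) : St V :=
  { σ with var := Function.update σ.var x a }

/-- Write `a` into column `c` of row `r`. -/
def St.write (σ : St V) (r c a : ℕ) : St V :=
  { σ with mem := Function.update σ.mem r (Function.update (σ.mem r) c a) }

@[simp] theorem St.var_set (σ : St V) (x y : V) (a : ℕ) :
    (σ.set x a).var y = if y = x then a else σ.var y := by
  simp [St.set, Function.update_apply]

@[simp] theorem St.mem_set (σ : St V) (x : V) (a : ℕ) : (σ.set x a).mem = σ.mem := rfl

omit [DecidableEq V] in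
@[simp] theorem St.var_write (σ : St V) (r c a : ℕ) : (σ.write r c a).var = σ.var := rfl

omit [DecidableEq V] in
theorem St.mem_write (σ : St V) (r c a r' c' : ℕ) :
    (σ.write r c a).mem r' c' = if r' = r ∧ c' = c then a else σ.mem r' c' := by
  by_cases h : r' = r
  · subst h; simp [St.write, Function.update_apply]
  · simp [St.write, h]

omit [DecidableEq V] in
theorem St.mem_write_row (σ : St V) {r r' : ℕ} (c a : ℕ) (h : r' ≠ r) :
    (σ.write r c a).mem r' = σ.mem r' := by
  simp [St.write, h]

/-- The value of a binary operation on natural numbers; subtraction is truncated at `0`. -/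
def BinOp.natEval : BinOp → ℕ → ℕ → ℕ
  | .sub, a, b => a - b
  | o, a, b => o.eval 0 a b

/-- A condition under which a binary operation on numbers below `M` has a value below `M` on the
machine that agrees with the one on natural numbers. -/
def BinOp.Safe (M : ℕ) : BinOp → ℕ → ℕ → Prop
  | .add, a, b => a + b < M
  | .sub, a, b => b ≤ a
  | .mul, a, b => a * b < M
  | .div, _, _ => True
  | .rem, _, _ => True
  | .eq, _, _ => True
  | .lt, _, _ => True
  | _, _, _ => False

theorem BinOp.Safe.eval_mod {W : ℕ} (hW : 0 < W) {o : BinOp} {a b : ℕ} (ha : a < 2 ^ W)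
    (hb : b < 2 ^ W) (h : o.Safe (2 ^ W) a b) :
    o.natEval a b < 2 ^ W ∧ o.eval W a b % 2 ^ W = o.natEval a b := by
  have h1 : 1 < 2 ^ W := Nat.one_lt_two_pow hW.ne'
  cases o <;> simp only [BinOp.Safe] at h <;> simp only [BinOp.natEval, BinOp.eval]
  case add => exact ⟨h, Nat.mod_eq_of_lt h⟩
  case sub =>
    refine ⟨by omega, ?_⟩
    rw [Nat.mod_eq_of_lt hb, show a + (2 ^ W - b) = (a - b) + 2 ^ W by omega, Nat.add_mod_right,
      Nat.mod_eq_of_lt (by omega)]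
  case mul => exact ⟨h, Nat.mod_eq_of_lt h⟩
  case div =>
    have := (Nat.div_le_self a b).trans_lt ha
    exact ⟨this, Nat.mod_eq_of_lt this⟩
  case rem =>
    have := (Nat.mod_le a b).trans_lt ha
    exact ⟨this, Nat.mod_eq_of_lt this⟩
  case eq =>
    have : (if a = b then 1 else 0) < 2 ^ W := by split <;> omega
    exact ⟨this, Nat.mod_eq_of_lt this⟩
  case lt =>
    have : (if a < b then 1 else 0) < 2 ^ W := by split <;> omega
    exact ⟨this, Nat.mod_eq_of_lt this⟩

/-- Expressions; `dim` is the number of columns of the memory. -/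
inductive Ex (V : Type) where
  | lit (n : ℕ)
  | dim
  | var (x : V)
  | op (o : BinOp) (a b : Ex V)
  | load (r c : Ex V)

/-- The value of an expression in unbounded arithmetic. -/
def Ex.eval (D : ℕ) (σ : St V) : Ex V → ℕ
  | lit n => n
  | dim => D
  | var x => σ.var x
  | op o a b => o.natEval (a.eval D σ) (b.eval D σ)
  | load r c => σ.mem (r.eval D σ) (c.eval D σ)

/-- The evaluation of an expression stays below `M` and within the columns of the memory. -/
def Ex.Ok (M D : ℕ) (σ : St V) : Ex V → Prop
  | lit n => n < M
  | dim => True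
  | var _ => True
  | op o a b => a.Ok M D σ ∧ b.Ok M D σ ∧ o.Safe M (a.eval D σ) (b.eval D σ)
  | load r c => r.Ok M D σ ∧ c.Ok M D σ ∧ c.eval D σ < D ∧ r.eval D σ * D + c.eval D σ < M

/-- Machine code that leaves the value of an expression in register `d`, and uses only registers
from `d` on. The number of columns is in register `0`, the variable `x` in register `ρ x`. -/
def Ex.compile (ρ : V → ℕ) : Ex V → ℕ → List Instr
  | lit n, d => [.const d n]
  | dim, d => [.copy d 0]
  | var x, d => [.copy d (ρ x)]
  | op o a b, d => a.compile ρ d ++ (b.compile ρ (d + 1) ++ [.op o d d (d + 1)])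
  | load r c, d => r.compile ρ d ++ ([.op .mul d d 0] ++ (c.compile ρ (d + 1) ++
      [.op .add d d (d + 1), .load d d]))

/-- Commands. The command `loop x y b` executes `b` for `x = 0, 1, …` below the value of `y`. -/
inductive Cmd (V : Type) where
  | skip
  | assign (x : V) (e : Ex V)
  | store (r c e : Ex V)
  | seq (s t : Cmd V)
  | ite (e : Ex V) (s t : Cmd V)
  | loop (x y : V) (b : Cmd V)

/-- The variables that a command assigns to. -/
def Cmd.writes : Cmd V → List V
  | skip => []
  | assign x _ => [x]
  | store _ _ _ => []
  | seq s t => s.writes ++ t.writes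
  | ite _ s t => s.writes ++ t.writes
  | loop x _ b => x :: b.writes

/-- Sufficient condition for a command to end in a state with property `Q`, such that all values
stay below `M` and all loops have at most `D` rounds. -/
def Cmd.wp (M D : ℕ) : Cmd V → (St V → Prop) → St V → Prop
  | skip, Q, σ => Q σ
  | assign x e, Q, σ => e.Ok M D σ ∧ Q (σ.set x (e.eval D σ))
  | store r c e, Q, σ => (Ex.load r c).Ok M D σ ∧ e.Ok M D σ ∧
      Q (σ.write (r.eval D σ) (c.eval D σ) (e.eval D σ))
  | seq s t, Q, σ => s.wp M D (t.wp M D Q) σ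
  | ite e s t, Q, σ => e.Ok M D σ ∧ (e.eval D σ ≠ 0 → s.wp M D Q σ) ∧
      (e.eval D σ = 0 → t.wp M D Q σ)
  | loop x y b, Q, σ => x ≠ y ∧ x ∉ b.writes ∧ y ∉ b.writes ∧ σ.var y ≤ D ∧
      ∃ I : ℕ → St V → Prop, I 0 σ ∧
        (∀ j τ, j < σ.var y → I j τ → b.wp M D (I (j + 1)) (τ.set x j)) ∧
        ∀ τ, I (σ.var y) τ → Q (τ.set x (σ.var y))

theorem Cmd.wp_mono {M D : ℕ} {s : Cmd V} {Q Q' : St V → Prop} (h : ∀ τ, Q τ → Q' τ) {σ : St V}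
    (hs : s.wp M D Q σ) : s.wp M D Q' σ := by
  induction s generalizing Q Q' σ with
  | skip => exact h _ hs
  | assign x e => exact ⟨hs.1, h _ hs.2⟩
  | store r c e => exact ⟨hs.1, hs.2.1, h _ hs.2.2⟩
  | seq s t ihs iht => exact ihs (fun τ hτ => iht h hτ) hs
  | ite e s t ihs iht => exact ⟨hs.1, fun he => ihs h (hs.2.1 he), fun he => iht h (hs.2.2 he)⟩
  | loop x y b ih =>
    obtain ⟨h1, h2, h3, h4, I, hI0, hI, hQ⟩ := hs
    exact ⟨h1, h2, h3, h4, I, hI0, hI, fun τ hτ => h _ (hQ τ hτ)⟩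

/-- Variables that a command does not assign to keep their values. -/
theorem Cmd.wp_frame {M D : ℕ} {s : Cmd V} {Q : St V → Prop} {σ : St V} (hs : s.wp M D Q σ) :
    s.wp M D (fun τ => Q τ ∧ ∀ z, z ∉ s.writes → τ.var z = σ.var z) σ := by
  induction s generalizing Q σ with
  | skip => exact ⟨hs, fun _ _ => rfl⟩
  | assign x e =>
    refine ⟨hs.1, hs.2, fun z hz => ?_⟩
    simp only [writes, List.mem_singleton] at hz
    simp [hz]
  | store r c e => exact ⟨hs.1, hs.2.1, hs.2.2, fun _ _ => rfl⟩
  | seq s t ihs iht =>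
    refine wp_mono (s := s) (fun τ hτ => ?_) (ihs hs)
    refine wp_mono (fun τ' hτ' => ?_) (iht hτ.1)
    refine ⟨hτ'.1, fun z hz => ?_⟩
    simp only [writes, List.mem_append, not_or] at hz
    rw [hτ'.2 z hz.2, hτ.2 z hz.1]
  | ite e s t ihs iht =>
    refine ⟨hs.1, fun he => wp_mono (fun τ hτ => ?_) (ihs (hs.2.1 he)),
      fun he => wp_mono (fun τ hτ => ?_) (iht (hs.2.2 he))⟩ <;>
    · refine ⟨hτ.1, fun z hz => ?_⟩
      simp only [writes, List.mem_append, not_or] at hz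
      first | exact hτ.2 z hz.1 | exact hτ.2 z hz.2
  | loop x y b ih =>
    obtain ⟨h1, h2, h3, h4, I, hI0, hI, hQ⟩ := hs
    refine ⟨h1, h2, h3, h4,
      fun j τ => I j τ ∧ ∀ z, z ∉ (loop x y b).writes → τ.var z = σ.var z,
      ⟨hI0, fun _ _ => rfl⟩, fun j τ hj hτ => ?_, fun τ hτ => ⟨hQ τ hτ.1, fun z hz => ?_⟩⟩
    · refine wp_mono (fun τ' hτ' => ⟨hτ'.1, fun z hz => ?_⟩) (ih (hI j τ hj hτ.1))
      have hz' := hz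
      simp only [writes, List.mem_cons, not_or] at hz
      rw [hτ'.2 z hz.2, ← hτ.2 z hz']
      simp [hz.1]
    · have hz' := hz
      simp only [writes, List.mem_cons, not_or] at hz
      rw [← hτ.2 z hz']
      simp [hz.1]

/-- The rule for loops, with the frame condition for variables built in. -/
theorem Cmd.wp_loop {M D : ℕ} {x y : V} {b : Cmd V} {Q : St V → Prop} {σ : St V}
    (I : ℕ → St V → Prop) (hxy : x ≠ y) (hx : x ∉ b.writes) (hy : y ∉ b.writes)
    (hD : σ.var y ≤ D) (h0 : I 0 σ)
    (hI : ∀ j τ, j < σ.var y → (∀ z, z ∉ (loop x y b).writes → τ.var z = σ.var z) → I j τ →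
      b.wp M D (I (j + 1)) (τ.set x j))
    (hQ : ∀ τ, (∀ z, z ∉ (loop x y b).writes → τ.var z = σ.var z) → I (σ.var y) τ →
      Q (τ.set x (σ.var y))) :
    (loop x y b).wp M D Q σ := by
  refine ⟨hxy, hx, hy, hD,
    fun j τ => I j τ ∧ ∀ z, z ∉ (loop x y b).writes → τ.var z = σ.var z,
    ⟨h0, fun _ _ => rfl⟩, fun j τ hj hτ => ?_, fun τ hτ => hQ τ hτ.2 hτ.1⟩
  refine wp_mono (fun τ' hτ' => ⟨hτ'.1, fun z hz => ?_⟩) (wp_frame (hI j τ hj hτ.2 hτ.1))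
  have hz' := hz
  simp only [writes, List.mem_cons, not_or] at hz
  rw [hτ'.2 z hz.2, ← hτ.2 z hz']
  simp [hz.1]

/-- Machine code for a command, to be placed at position `pos`; registers from `K` on are used for
intermediate results. -/
def Cmd.compile (ρ : V → ℕ) (K : ℕ) : Cmd V → ℕ → List Instr
  | skip, _ => []
  | assign x e, _ => e.compile ρ K ++ [.copy (ρ x) K]
  | store r c e, _ => r.compile ρ K ++ ([.op .mul K K 0] ++ (c.compile ρ (K + 1) ++
      ([.op .add K K (K + 1)] ++ (e.compile ρ (K + 1) ++ [.store K (K + 1)]))))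
  | seq s t, pos => s.compile ρ K pos ++ t.compile ρ K (pos + (s.compile ρ K pos).length)
  | ite e s t, pos =>
      let ce := e.compile ρ K
      let ps := pos + ce.length + 1
      let cs := s.compile ρ K ps
      let pt := ps + cs.length + 1
      let ct := t.compile ρ K pt
      ce ++ ([.jumpZero K pt] ++ (cs ++ ([.jump (pt + ct.length)] ++ ct)))
  | loop x y b, pos =>
      let cb := b.compile ρ K (pos + 3)
      [.const (ρ x) 0, .op .lt K (ρ x) (ρ y), .jumpZero K (pos + 3 + cb.length + 3)] ++
        (cb ++ [.const K 1, .op .add (ρ x) (ρ x) K, .jump (pos + 1)])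

/-- A bound for the number of steps of the compiled command, as a polynomial in a bound for the
number of rounds of each loop. -/
noncomputable def Cmd.time (ρ : V → ℕ) (K : ℕ) : Cmd V → Polynomial ℕ
  | skip => 0
  | assign x e => (((assign x e).compile ρ K 0).length : Polynomial ℕ)
  | store r c e => (((store r c e).compile ρ K 0).length : Polynomial ℕ)
  | seq s t => s.time ρ K + t.time ρ K
  | ite e s t => (((e.compile ρ K).length + 2 : ℕ) : Polynomial ℕ) + (s.time ρ K + t.time ρ K)
  | loop _ _ b => 3 + Polynomial.X * (b.time ρ K + 5)

/-- The list `L` of instructions stands at position `pos` of the program `P`. -/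
def CodeAt (P : Program) (pos : ℕ) (L : List Instr) : Prop :=
  ∀ i (h : i < L.length), P[pos + i]? = some L[i]

theorem CodeAt.append {P : Program} {pos : ℕ} {L L' : List Instr} (h : CodeAt P pos (L ++ L')) :
    CodeAt P pos L ∧ CodeAt P (pos + L.length) L' := by
  constructor
  · intro i hi
    rw [h i (by simp; omega), List.getElem_append_left hi]
  · intro i hi
    rw [add_assoc, h (L.length + i) (by simp; omega), List.getElem_append_right (by omega)]
    simp

theorem CodeAt.head {P : Program} {pos : ℕ} {a : Instr} {L : List Instr}
    (h : CodeAt P pos (a :: L)) : P[pos]? = some a := by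
  exact h 0 (Nat.succ_pos _)

theorem CodeAt.tail {P : Program} {pos : ℕ} {a : Instr} {L : List Instr}
    (h : CodeAt P pos (a :: L)) : CodeAt P (pos + 1) L := by
  simpa using (CodeAt.append (L := [a]) h).2

/-- The machine goes from `c` to `c'` in at most `T` steps. -/
def Reaches (W : ℕ) (P : Program) (T : ℕ) (c c' : Config) : Prop :=
  ∃ t ≤ T, (step W P)^[t] c = c'

theorem Reaches.refl (W : ℕ) (P : Program) (c : Config) : Reaches W P 0 c c := ⟨0, le_rfl, rfl⟩

theorem Reaches.trans {W : ℕ} {P : Program} {T T' : ℕ} {c c' c'' : Config}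
    (h : Reaches W P T c c') (h' : Reaches W P T' c' c'') : Reaches W P (T + T') c c'' := by
  obtain ⟨t, ht, rfl⟩ := h
  obtain ⟨t', ht', rfl⟩ := h'
  exact ⟨t' + t, by omega, Function.iterate_add_apply _ _ _ _⟩

theorem Reaches.mono {W : ℕ} {P : Program} {T T' : ℕ} {c c' : Config} (h : Reaches W P T c c')
    (hT : T ≤ T') : Reaches W P T' c c' := by
  obtain ⟨t, ht, h⟩ := h
  exact ⟨t, ht.trans hT, h⟩

theorem Reaches.of_step {W : ℕ} {P : Program} {c : Config} {I : Instr} (h : P[c.pc]? = some I) :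
    Reaches W P 1 c (I.exec W c) :=
  ⟨1, le_rfl, by simp [step, h]⟩

/-- The machine configuration `c` represents the state `σ`. -/
structure Rel (ρ : V → ℕ) (W D : ℕ) (σ : St V) (c : Config) : Prop where
  dim : c.reg 0 = D
  dim_lt : D < 2 ^ W
  var : ∀ x, c.reg (ρ x) = σ.var x
  var_lt : ∀ x, σ.var x < 2 ^ W
  mem : ∀ i j, j < D → c.mem (i * D + j) = σ.mem i j
  mem_lt : ∀ i j, j < D → σ.mem i j < 2 ^ W

/-- The register `0` and the registers that are used for variables lie below `K`. -/
structure IsLayout (ρ : V → ℕ) (K : ℕ) : Prop where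
  inj : Function.Injective ρ
  pos : ∀ x, 0 < ρ x
  lt : ∀ x, ρ x < K

omit [DecidableEq V] in
theorem Rel.of_agree {ρ : V → ℕ} {K W D : ℕ} (hρ : IsLayout ρ K) (hK : 0 < K) {σ : St V}
    {c c' : Config} (h : Rel ρ W D σ c) (hr : ∀ r < K, c'.reg r = c.reg r) (hm : c'.mem = c.mem) :
    Rel ρ W D σ c' :=
  ⟨(hr 0 hK).trans h.dim, h.dim_lt, fun x => (hr _ (hρ.lt x)).trans (h.var x), h.var_lt,
    fun i j hj => hm ▸ h.mem i j hj, h.mem_lt⟩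

theorem Rel.set {ρ : V → ℕ} {K W D : ℕ} (hρ : IsLayout ρ K) {σ : St V} {c c' : Config}
    (h : Rel ρ W D σ c) {x : V} {a : ℕ} (ha : a < 2 ^ W)
    (hr : ∀ r < K, c'.reg r = if r = ρ x then a else c.reg r) (hm : c'.mem = c.mem) :
    Rel ρ W D (σ.set x a) c' := by
  have hK : 0 < K := (hρ.pos x).trans (hρ.lt x)
  refine ⟨?_, h.dim_lt, fun y => ?_, fun y => ?_, fun i j hj => hm ▸ h.mem i j hj, h.mem_lt⟩
  · rw [hr 0 hK, if_neg (hρ.pos x).ne, h.dim]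
  · rw [hr _ (hρ.lt y), St.var_set]
    simp only [hρ.inj.eq_iff, h.var]
  · rw [St.var_set]
    split
    · exact ha
    · exact h.var_lt y

omit [DecidableEq V] in
theorem Ex.eval_lt {ρ : V → ℕ} {W D : ℕ} (hW : 0 < W) {σ : St V} {c : Config}
    (h : Rel ρ W D σ c) {e : Ex V} (he : e.Ok (2 ^ W) D σ) : e.eval D σ < 2 ^ W := by
  induction e with
  | lit n => exact he
  | dim => exact h.dim_lt
  | var x => exact h.var_lt x
  | op o a b iha ihb => exact (he.2.2.eval_mod hW (iha he.1) (ihb he.2.1)).1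
  | load r c => exact h.mem_lt _ _ he.2.2.1

omit [DecidableEq V] in
theorem Ex.compile_spec {ρ : V → ℕ} {K W D : ℕ} (hρ : IsLayout ρ K) (hK : 0 < K) (hW : 0 < W)
    {P : Program} {σ : St V} {e : Ex V} (he : e.Ok (2 ^ W) D σ) {d : ℕ} (hd : K ≤ d)
    {c : Config} (h : Rel ρ W D σ c) (hc : CodeAt P c.pc (e.compile ρ d)) :
    ∃ c', Reaches W P (e.compile ρ d).length c c' ∧ c'.pc = c.pc + (e.compile ρ d).length ∧
      c'.reg d = e.eval D σ ∧ (∀ r < d, c'.reg r = c.reg r) ∧ c'.mem = c.mem := by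
  induction e generalizing d c with
  | lit n =>
    refine ⟨_, Reaches.of_step hc.head, rfl, ?_, fun r hr => ?_, rfl⟩
    · simpa [Instr.exec, Config.setReg, eval] using Nat.mod_eq_of_lt he
    · simp [Instr.exec, Config.setReg, hr.ne]
  | dim =>
    refine ⟨_, Reaches.of_step hc.head, rfl, ?_, fun r hr => ?_, rfl⟩
    · simpa [Instr.exec, Config.setReg, eval, h.dim] using Nat.mod_eq_of_lt h.dim_lt
    · simp [Instr.exec, Config.setReg, hr.ne]
  | var x =>
    refine ⟨_, Reaches.of_step hc.head, rfl, ?_, fun r hr => ?_, rfl⟩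
    · simpa [Instr.exec, Config.setReg, eval, h.var] using Nat.mod_eq_of_lt (h.var_lt x)
    · simp [Instr.exec, Config.setReg, hr.ne]
  | op o a b iha ihb =>
    obtain ⟨hca, hcb'⟩ := hc.append
    obtain ⟨hcb, hco⟩ := hcb'.append
    obtain ⟨c₁, h₁, hp₁, hv₁, hr₁, hm₁⟩ := iha he.1 hd h hca
    have hR₁ : Rel ρ W D σ c₁ := h.of_agree hρ hK (fun r hr => hr₁ r (by omega)) hm₁
    obtain ⟨c₂, h₂, hp₂, hv₂, hr₂, hm₂⟩ :=
      ihb he.2.1 (d := d + 1) (by omega) hR₁ (by rw [hp₁]; exact hcb)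
    rw [← hp₁, ← hp₂] at hco
    have key := (he.2.2.eval_mod hW (eval_lt hW h he.1) (eval_lt hW h he.2.1)).2
    refine ⟨_, ((h₁.trans h₂).trans (Reaches.of_step hco.head)).mono ?_, ?_, ?_,
      fun r hr => ?_, ?_⟩
    · simp [compile, add_assoc]
    · simp [Instr.exec, Config.setReg, compile, hp₁, hp₂]; omega
    · simp only [Instr.exec, Config.setReg, Function.update_self]
      rw [hv₂, hr₂ d (by omega), hv₁]
      exact key
    · simp only [Instr.exec, Config.setReg]
      rw [Function.update_of_ne hr.ne, hr₂ r (by omega), hr₁ r hr]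
    · exact hm₂.trans hm₁
  | load a b iha ihb =>
    obtain ⟨ha, hb, hlt, haddr⟩ := he
    obtain ⟨hca, hc₁⟩ := hc.append
    obtain ⟨hcm, hc₂⟩ := hc₁.append
    obtain ⟨hcb, hco⟩ := hc₂.append
    obtain ⟨c₁, h₁, hp₁, hv₁, hr₁, hm₁⟩ := iha ha hd h hca
    rw [← hp₁] at hcm
    have hmul : a.eval D σ * D < 2 ^ W := by omega
    set c₂ := (Instr.op .mul d d 0).exec W c₁ with hc₂def
    have h₂ : Reaches W P 1 c₁ c₂ := Reaches.of_step hcm.head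
    have hp₂ : c₂.pc = c₁.pc + 1 := rfl
    have hr₂ : ∀ r < d, c₂.reg r = c₁.reg r := fun r hr => by
      simp [hc₂def, Instr.exec, Config.setReg, hr.ne]
    have hv₂ : c₂.reg d = a.eval D σ * D := by
      have h0 : c₁.reg 0 = D := (hr₁ 0 (by omega)).trans h.dim
      simp [hc₂def, Instr.exec, Config.setReg, BinOp.eval, hv₁, h0, Nat.mod_eq_of_lt hmul]
    have hm₂ : c₂.mem = c.mem := hm₁
    have hR₂ : Rel ρ W D σ c₂ := h.of_agree hρ hK
      (fun r hr => (hr₂ r (by omega)).trans (hr₁ r (by omega))) hm₂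
    obtain ⟨c₃, h₃, hp₃, hv₃, hr₃, hm₃⟩ := ihb hb (d := d + 1) (by omega) hR₂ (by
      rw [hp₂, hp₁]; exact hcb)
    simp only [List.length_singleton] at hco
    rw [← hp₁, ← hp₂, ← hp₃] at hco
    set c₄ := (Instr.op .add d d (d + 1)).exec W c₃ with hc₄def
    have h₄ : Reaches W P 1 c₃ c₄ := Reaches.of_step hco.head
    have hv₄ : c₄.reg d = a.eval D σ * D + b.eval D σ := by
      simp [hc₄def, Instr.exec, Config.setReg, BinOp.eval, hv₃, hr₃ d (by omega), hv₂,
        Nat.mod_eq_of_lt haddr]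
    have h₅ : Reaches W P 1 c₄ ((Instr.load d d).exec W c₄) := Reaches.of_step hco.tail.head
    have hm₄ : c₄.mem = c.mem := hm₃.trans hm₂
    refine ⟨_, ((((h₁.trans h₂).trans h₃).trans h₄).trans h₅).mono ?_, ?_, ?_, fun r hr => ?_, hm₄⟩
    · simp [compile]; omega
    · simp [Instr.exec, Config.setReg, hc₄def, compile, hp₁, hp₂, hp₃]; omega
    · simp only [Instr.exec, Config.setReg, Function.update_self]
      rw [hv₄, hm₄, h.mem _ _ hlt]
      exact Nat.mod_eq_of_lt (h.mem_lt _ _ hlt)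
    · simp only [Instr.exec, Config.setReg]
      rw [Function.update_of_ne hr.ne]
      simp only [hc₄def, Instr.exec, Config.setReg]
      rw [Function.update_of_ne hr.ne, hr₃ r (by omega), hr₂ r hr, hr₁ r hr]

/-- The compiled command does what the command does. -/
theorem Cmd.compile_spec {ρ : V → ℕ} {K W D : ℕ} (hρ : IsLayout ρ K) (hK : 0 < K) (hW : 0 < W)
    {P : Program} {s : Cmd V} {Q : St V → Prop} {σ : St V} (hs : s.wp (2 ^ W) D Q σ)
    {c : Config} (h : Rel ρ W D σ c) (hc : CodeAt P c.pc (s.compile ρ K c.pc)) :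
    ∃ c' σ', Reaches W P ((s.time ρ K).eval D) c c' ∧
      c'.pc = c.pc + (s.compile ρ K c.pc).length ∧ Rel ρ W D σ' c' ∧ Q σ' := by
  induction s generalizing Q σ c with
  | skip => exact ⟨c, σ, (Reaches.refl _ _ _).mono (by simp), by simp [compile], h, hs⟩
  | assign x e =>
    obtain ⟨he, hQ⟩ := hs
    obtain ⟨hce, hco⟩ := hc.append
    obtain ⟨c₁, h₁, hp₁, hv₁, hr₁, hm₁⟩ := e.compile_spec hρ hK hW he le_rfl h hce
    rw [← hp₁] at hco
    have hlt := Ex.eval_lt hW h he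
    refine ⟨_, _, (h₁.trans (Reaches.of_step hco.head)).mono ?_, ?_,
      h.set hρ hlt (x := x) (fun r hr => ?_) hm₁, hQ⟩
    · simp [time, compile]
    · simp [Instr.exec, Config.setReg, compile, hp₁]; omega
    · simp only [Instr.exec, Config.setReg, Function.update_apply, hv₁, Nat.mod_eq_of_lt hlt,
        hr₁ r hr]
  | store a b e =>
    obtain ⟨⟨ha, hb, hlt, haddr⟩, he, hQ⟩ := hs
    obtain ⟨hca, hc₁⟩ := hc.append
    obtain ⟨hcm, hc₂⟩ := hc₁.append
    obtain ⟨hcb, hc₃⟩ := hc₂.append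
    obtain ⟨hcadd, hc₄⟩ := hc₃.append
    obtain ⟨hce, hco⟩ := hc₄.append
    obtain ⟨c₁, h₁, hp₁, hv₁, hr₁, hm₁⟩ := a.compile_spec hρ hK hW ha le_rfl h hca
    rw [← hp₁] at hcm
    have hmul : a.eval D σ * D < 2 ^ W := by omega
    set c₂ := (Instr.op .mul K K 0).exec W c₁ with hc₂def
    have h₂ : Reaches W P 1 c₁ c₂ := Reaches.of_step hcm.head
    have hp₂ : c₂.pc = c₁.pc + 1 := rfl
    have hr₂ : ∀ r < K, c₂.reg r = c.reg r := fun r hr => by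
      simp [hc₂def, Instr.exec, Config.setReg, hr.ne, hr₁ r hr]
    have hv₂ : c₂.reg K = a.eval D σ * D := by
      have h0 : c₁.reg 0 = D := (hr₁ 0 (by omega)).trans h.dim
      simp [hc₂def, Instr.exec, Config.setReg, BinOp.eval, hv₁, h0, Nat.mod_eq_of_lt hmul]
    have hm₂ : c₂.mem = c.mem := hm₁
    have hR₂ : Rel ρ W D σ c₂ := h.of_agree hρ hK hr₂ hm₂
    simp only [List.length_singleton] at hcb hcadd hce hco
    obtain ⟨c₃, h₃, hp₃, hv₃, hr₃, hm₃⟩ :=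
      b.compile_spec hρ hK hW hb (d := K + 1) (by omega) hR₂ (by rw [hp₂, hp₁]; exact hcb)
    rw [← hp₁, ← hp₂, ← hp₃] at hcadd
    set c₄ := (Instr.op .add K K (K + 1)).exec W c₃ with hc₄def
    have h₄ : Reaches W P 1 c₃ c₄ := Reaches.of_step hcadd.head
    have hp₄ : c₄.pc = c₃.pc + 1 := rfl
    have hv₄ : c₄.reg K = a.eval D σ * D + b.eval D σ := by
      simp [hc₄def, Instr.exec, Config.setReg, BinOp.eval, hv₃, hr₃ K (by omega), hv₂,
        Nat.mod_eq_of_lt haddr]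
    have hm₄ : c₄.mem = c.mem := hm₃.trans hm₂
    have hR₄ : Rel ρ W D σ c₄ := hR₂.of_agree hρ hK (fun r hr => by
      simp [hc₄def, Instr.exec, Config.setReg, hr.ne, hr₃ r (by omega)]) hm₃
    obtain ⟨c₅, h₅, hp₅, hv₅, hr₅, hm₅⟩ :=
      e.compile_spec hρ hK hW he (d := K + 1) (by omega) hR₄ (by
        rw [hp₄, hp₃, hp₂, hp₁]; exact hce)
    rw [← hp₁, ← hp₂, ← hp₃, ← hp₄, ← hp₅] at hco
    have hlte := Ex.eval_lt hW h he
    refine ⟨_, _, (((((h₁.trans h₂).trans h₃).trans h₄).trans h₅).trans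
      (Reaches.of_step hco.head)).mono ?_, ?_, ?_, hQ⟩
    · simp [time, compile]; omega
    · simp [Instr.exec, compile, hp₁, hp₂, hp₃, hp₄, hp₅]; omega
    · have hR₅ : Rel ρ W D σ c₅ := hR₄.of_agree hρ hK (fun r hr => hr₅ r (by omega)) hm₅
      refine ⟨hR₅.dim, hR₅.dim_lt, hR₅.var, hR₅.var_lt, fun i j hj => ?_, fun i j hj => ?_⟩
      · simp only [Instr.exec]
        rw [hr₅ K (by omega), hv₄, hv₅, Function.update_apply, St.mem_write, hR₅.mem i j hj]
        refine if_congr ⟨fun hij => ?_, fun hij => by rw [hij.1, hij.2]⟩ rfl rfl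
        have hD : 0 < D := by omega
        have h1 := congrArg (· / D) hij
        have h2 := congrArg (· % D) hij
        simp only [mul_comm _ D, Nat.mul_add_div hD, Nat.mul_add_mod, Nat.div_eq_of_lt hj,
          Nat.div_eq_of_lt hlt, Nat.mod_eq_of_lt hj, Nat.mod_eq_of_lt hlt, add_zero] at h1 h2
        exact ⟨h1, h2⟩
      · rw [St.mem_write]
        split
        · exact hlte
        · exact h.mem_lt i j hj
  | seq s t ihs iht =>
    obtain ⟨hcs, hct⟩ := hc.append
    obtain ⟨c₁, σ₁, h₁, hp₁, hR₁, hQ₁⟩ := ihs hs h hcs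
    obtain ⟨c₂, σ₂, h₂, hp₂, hR₂, hQ₂⟩ := iht hQ₁ hR₁ (by rw [hp₁]; exact hct)
    refine ⟨c₂, σ₂, (h₁.trans h₂).mono (by simp [time]), ?_, hR₂, hQ₂⟩
    rw [hp₂, hp₁]
    simp [compile]; omega
  | ite e s t ihs iht =>
    obtain ⟨he, hQs, hQt⟩ := hs
    obtain ⟨hce, hc₁⟩ := hc.append
    obtain ⟨hcj, hc₂⟩ := hc₁.append
    obtain ⟨hcs, hc₃⟩ := hc₂.append
    obtain ⟨hcj', hct⟩ := hc₃.append
    simp only [List.length_singleton] at hcs hcj' hct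
    obtain ⟨c₁, h₁, hp₁, hv₁, hr₁, hm₁⟩ := e.compile_spec hρ hK hW he le_rfl h hce
    rw [← hp₁] at hcj
    set c₂ := (Instr.jumpZero K _).exec W c₁ with hc₂def
    have h₂ : Reaches W P 1 c₁ c₂ := Reaches.of_step hcj.head
    have hR₂ : Rel ρ W D σ c₂ := h.of_agree hρ hK hr₁ hm₁
    by_cases h0 : e.eval D σ = 0
    · have hp₂ : c₂.pc = c.pc + (e.compile ρ K).length + 1 +
          (s.compile ρ K (c.pc + (e.compile ρ K).length + 1)).length + 1 := by
        simp [hc₂def, Instr.exec, hv₁, h0, hp₁]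
      obtain ⟨c₃, σ₃, h₃, hp₃, hR₃, hQ₃⟩ := iht (hQt h0) hR₂ (by rw [hp₂]; exact hct)
      refine ⟨c₃, σ₃, ((h₁.trans h₂).trans h₃).mono ?_, ?_, hR₃, hQ₃⟩
      · simp [time]; omega
      · rw [hp₃, hp₂]; simp [compile]; omega
    · have hp₂ : c₂.pc = c.pc + (e.compile ρ K).length + 1 := by
        simp [hc₂def, Instr.exec, hv₁, h0, hp₁]
      obtain ⟨c₃, σ₃, h₃, hp₃, hR₃, hQ₃⟩ := ihs (hQs h0) hR₂ (by rw [hp₂]; exact hcs)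
      rw [← hp₂, ← hp₃] at hcj'
      refine ⟨_, σ₃, (((h₁.trans h₂).trans h₃).trans (Reaches.of_step hcj'.head)).mono ?_, ?_,
        ?_, hQ₃⟩
      · simp [time]; omega
      · simp [Instr.exec, compile, hp₃, hp₂]; omega
      · exact ⟨hR₃.dim, hR₃.dim_lt, hR₃.var, hR₃.var_lt, hR₃.mem, hR₃.mem_lt⟩
  | loop x y b ih =>
    obtain ⟨hxy, hx, hy, hD, I, hI0, hI, hQ⟩ := hs
    obtain ⟨hc₀, hc₁⟩ := hc.append
    obtain ⟨hcb, hc₂⟩ := hc₁.append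
    simp only [List.length_cons, List.length_nil, zero_add, Nat.reduceAdd] at hcb hc₂
    have h1W : 1 < 2 ^ W := Nat.one_lt_two_pow hW.ne'
    set lb := (b.compile ρ K (c.pc + 3)).length with hlb
    -- the state at the head of the loop after `j` rounds
    have head : ∀ j ≤ σ.var y, ∃ c' τ, Reaches W P (1 + j * ((b.time ρ K).eval D + 5)) c c' ∧
        c'.pc = c.pc + 1 ∧ Rel ρ W D (τ.set x j) c' ∧ I j τ ∧ τ.var y = σ.var y := by
      intro j
      induction j with
      | zero =>
        intro _
        refine ⟨_, σ, (Reaches.of_step hc₀.head).mono (by simp), rfl,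
          h.set hρ (by omega) (fun r hr => ?_) rfl, hI0, rfl⟩
        simp [Instr.exec, Config.setReg, Function.update_apply]
      | succ j ihj =>
        intro hj
        obtain ⟨c₁, τ, h₁, hp₁, hR₁, hIτ, hτy⟩ := ihj (by omega)
        have hct := hc₀.tail
        rw [← hp₁] at hct
        set c₂ := (Instr.op .lt K (ρ x) (ρ y)).exec W c₁ with hc₂def
        have h₂ : Reaches W P 1 c₁ c₂ := Reaches.of_step hct.head
        have hv₂ : c₂.reg K = 1 := by
          have : j < σ.var y := by omega
          simp [hc₂def, Instr.exec, Config.setReg, BinOp.eval, hR₁.var, hxy.symm, hτy, this,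
            Nat.mod_eq_of_lt h1W]
        have hp₂ : c₂.pc = c₁.pc + 1 := rfl
        have hR₂ : Rel ρ W D (τ.set x j) c₂ := hR₁.of_agree hρ hK (fun r hr => by
          simp [hc₂def, Instr.exec, Config.setReg, hr.ne]) rfl
        have hct' := hct.tail
        rw [← hp₂] at hct'
        set c₃ := (Instr.jumpZero K (c.pc + 3 + lb + 3)).exec W c₂ with hc₃def
        have h₃ : Reaches W P 1 c₂ c₃ := Reaches.of_step hct'.head
        have hp₃ : c₃.pc = c.pc + 3 := by
          simp [hc₃def, Instr.exec, hv₂, hp₂, hp₁]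
        have hR₃ : Rel ρ W D (τ.set x j) c₃ := hR₂.of_agree hρ hK (fun r hr => rfl) rfl
        obtain ⟨c₄, τ', h₄, hp₄, hR₄, hI₄, hfr⟩ :=
          ih (wp_frame (hI j τ (by omega) hIτ)) hR₃ (by rw [hp₃]; exact hcb)
        rw [hp₃, ← hlb] at hp₄
        rw [← hp₄] at hc₂
        set c₅ := (Instr.const K 1).exec W c₄ with hc₅def
        have h₅ : Reaches W P 1 c₄ c₅ := Reaches.of_step hc₂.head
        have hp₅ : c₅.pc = c₄.pc + 1 := rfl
        have hR₅ : Rel ρ W D τ' c₅ := hR₄.of_agree hρ hK (fun r hr => by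
          simp [hc₅def, Instr.exec, Config.setReg, hr.ne]) rfl
        have hv₅ : c₅.reg K = 1 := by
          simp [hc₅def, Instr.exec, Config.setReg, Nat.mod_eq_of_lt h1W]
        have hc₆ := hc₂.tail
        rw [← hp₅] at hc₆
        set c₆ := (Instr.op .add (ρ x) (ρ x) K).exec W c₅ with hc₆def
        have h₆ : Reaches W P 1 c₅ c₆ := Reaches.of_step hc₆.head
        have hlt : j + 1 < 2 ^ W := hj.trans_lt (h.var_lt y)
        have hx' : τ'.var x = j := by rw [hfr x hx]; simp
        have hR₆ : Rel ρ W D (τ'.set x (j + 1)) c₆ := hR₅.set hρ hlt (fun r hr => by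
          simp [hc₆def, Instr.exec, Config.setReg, Function.update_apply, BinOp.eval, hR₅.var, hv₅,
            hx', Nat.mod_eq_of_lt hlt]) rfl
        have hc₇ := hc₆.tail
        have hp₆ : c₆.pc = c₅.pc + 1 := rfl
        rw [← hp₆] at hc₇
        refine ⟨_, τ', ((((((h₁.trans h₂).trans h₃).trans h₄).trans h₅).trans h₆).trans
          (Reaches.of_step hc₇.head)).mono ?_, rfl, ?_, hI₄, ?_⟩
        · rw [add_mul]; omega
        · exact ⟨hR₆.dim, hR₆.dim_lt, hR₆.var, hR₆.var_lt, hR₆.mem, hR₆.mem_lt⟩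
        · rw [hfr y hy]; simp [hxy.symm, hτy]
    obtain ⟨c₁, τ, h₁, hp₁, hR₁, hIτ, hτy⟩ := head _ le_rfl
    have hct := hc₀.tail
    rw [← hp₁] at hct
    set c₂ := (Instr.op .lt K (ρ x) (ρ y)).exec W c₁ with hc₂def
    have h₂ : Reaches W P 1 c₁ c₂ := Reaches.of_step hct.head
    have hv₂ : c₂.reg K = 0 := by
      simp [hc₂def, Instr.exec, Config.setReg, BinOp.eval, hR₁.var, hxy.symm, hτy]
    have hp₂ : c₂.pc = c₁.pc + 1 := rfl
    have hR₂ : Rel ρ W D (τ.set x (σ.var y)) c₂ := hR₁.of_agree hρ hK (fun r hr => by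
      simp [hc₂def, Instr.exec, Config.setReg, hr.ne]) rfl
    have hct' := hct.tail
    rw [← hp₂] at hct'
    refine ⟨_, _, ((h₁.trans h₂).trans (Reaches.of_step hct'.head)).mono ?_, ?_,
      hR₂.of_agree hρ hK (fun r hr => rfl) rfl, hQ τ hIτ⟩
    · have := Nat.mul_le_mul_right ((b.time ρ K).eval D + 5) hD
      simp only [time, Polynomial.eval_add, Polynomial.eval_mul, Polynomial.eval_X,
        Polynomial.eval_ofNat]
      omega
    · simp [Instr.exec, hv₂, compile, ← hlb]; omega

end WordRAM

/-! ### Binomial coefficients of words -/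

section WordBinom

variable {A : Type} [DecidableEq A]

theorem wordBinom_nil_concat (y : List A) (a : A) : wordBinom [] (y ++ [a]) = 0 := by
  simp [wordBinom]

theorem wordBinom_nil_right (u : List A) : wordBinom u [] = 1 := by
  induction u using List.reverseRecOn with
  | nil => simp [wordBinom]
  | append_singleton u b ih =>
    rw [wordBinom, List.sublists_concat, List.count_append,
      List.count_eq_zero_of_not_mem (l := List.map _ _) (by simp)]
    exact ih

theorem wordBinom_concat_concat (u y : List A) (a b : A) :
    wordBinom (u ++ [b]) (y ++ [a]) =
      wordBinom u (y ++ [a]) + if b = a then wordBinom u y else 0 := by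
  rw [wordBinom, List.sublists_concat, List.count_append]
  congr 1
  split_ifs with h
  · subst h
    exact List.count_map_of_injective _ (fun x => x ++ [b]) (List.append_left_injective [b]) y
  · refine List.count_eq_zero_of_not_mem fun hm => ?_
    obtain ⟨z, -, hz⟩ := List.mem_map.1 hm
    exact h (by simpa using (List.append_inj_right' hz rfl))

theorem wordBinom_eq_zero_of_length_lt {u y : List A} (h : u.length < y.length) :
    wordBinom u y = 0 :=
  List.count_eq_zero_of_not_mem fun hm => h.not_ge (List.mem_sublists.1 hm).length_le

theorem wordBinom_le (u y : List A) : wordBinom u y ≤ 2 ^ u.length :=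
  List.count_le_length.trans_eq (List.length_sublists u)

theorem wordBinom_map {B : Type} [DecidableEq B] {f : A → B} (hf : Function.Injective f)
    (u y : List A) : wordBinom (u.map f) (y.map f) = wordBinom u y := by
  rw [wordBinom, List.sublists_map]
  exact List.count_map_of_injective _ _ hf.list_map y

theorem binomEquiv_map {B : Type} [DecidableEq B] {f : A → B} (hf : Function.Injective f) (k : ℕ)
    (u x : List A) : BinomEquiv k (u.map f) (x.map f) ↔ BinomEquiv k u x := by
  refine ⟨fun h y hy => ?_, fun h y hy => ?_⟩
  · rw [← wordBinom_map hf, ← wordBinom_map hf]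
    exact h _ (by simpa using hy)
  · by_cases hm : ∃ z : List A, z.map f = y
    · obtain ⟨z, rfl⟩ := hm
      rw [wordBinom_map hf, wordBinom_map hf]
      exact h _ (by simpa using hy)
    · have h0 : ∀ v : List A, wordBinom (v.map f) y = 0 := fun v => by
        refine List.count_eq_zero_of_not_mem fun hv => hm ?_
        rw [List.sublists_map, List.mem_map] at hv
        exact ⟨_, hv.choose_spec.2⟩
      rw [h0, h0]

/-- For words of length at most `N`, only words of length at most `N` matter. -/
theorem binomEquiv_min {u x : List A} {N : ℕ} (hu : u.length ≤ N) (hx : x.length ≤ N) (k : ℕ) :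
    BinomEquiv (min k N) u x ↔ BinomEquiv k u x := by
  refine ⟨fun h y hy => ?_, fun h y hy => h y (hy.trans (min_le_left _ _))⟩
  by_cases hN : y.length ≤ N
  · exact h y (le_min hy hN)
  · rw [wordBinom_eq_zero_of_length_lt (by omega), wordBinom_eq_zero_of_length_lt (by omega)]

end WordBinom

/-! ### Small primes that distinguish two numbers -/

theorem exists_prime_not_modEq {N a b : ℕ} (hN : 3 ≤ N) (ha : a ≤ 2 ^ N) (hb : b ≤ 2 ^ N)
    (hab : a ≠ b) : ∃ p, p.Prime ∧ p ≤ N ^ 4 ∧ ¬ a ≡ b [MOD p] := by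
  wlog hlt : a < b generalizing a b
  · obtain ⟨p, hp, hpN, h⟩ := this hb ha hab.symm (by omega)
    exact ⟨p, hp, hpN, fun h' => h h'.symm⟩
  by_contra! hcon
  have hdvd : primorial (N ^ 4) ∣ b - a := by
    refine Finset.prod_primes_dvd _ (fun p hp => ?_) (fun p hp => ?_)
    · exact (Finset.mem_filter.1 hp).2.prime
    · obtain ⟨h1, h2⟩ := Finset.mem_filter.1 hp
      exact (Nat.modEq_iff_dvd' hlt.le).1 (hcon p h2 (by simpa [Nat.lt_succ_iff] using h1))
  have hle : primorial (N ^ 4) ≤ 2 ^ N := (Nat.le_of_dvd (by omega) hdvd).trans (by omega)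
  have hcard : (Nat.primesLE (N ^ 4)).card ≤ N := by
    refine (Nat.pow_le_pow_iff_right (a := 2) (by norm_num)).1 (le_trans ?_ hle)
    rw [primorial]
    refine (Finset.pow_card_le_prod (s := Nat.primesLE (N ^ 4)) (f := fun p => p) (n := 2) ?_)
    intro p hp
    exact (Nat.mem_primesLE.1 hp).2.two_le
  have hlcm : Nat.lcmUpto (N ^ 4) ≤ (N ^ 4) ^ N := by
    rw [Nat.lcmUpto_eq_prod_pow_log]
    calc _ ≤ ∏ p ∈ Nat.primesLE (N ^ 4), N ^ 4 :=
          Finset.prod_le_prod' fun p _ => Nat.pow_log_le_self p (by positivity)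
      _ ≤ (N ^ 4) ^ N := by
          rw [Finset.prod_const]
          exact Nat.pow_le_pow_right (by positivity) hcard
  have h2 := Chebyshev.two_pow_le_mul_lcmUpto (N ^ 4)
  have hNlt : N < 2 ^ N := Nat.lt_two_pow_self
  have hN4 : N ^ 4 ≤ 2 ^ (4 * N) := by
    rw [mul_comm, pow_mul]; exact Nat.pow_le_pow_left hNlt.le 4
  have hN4' : N ^ 4 + 1 ≤ 2 ^ (4 * N + 1) := by
    have := Nat.one_le_two_pow (n := 4 * N)
    rw [pow_succ 2]; omega
  have h3 : (N ^ 4) ^ N ≤ 2 ^ (4 * N * N) := by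
    rw [pow_mul 2 (4 * N)]; exact Nat.pow_le_pow_left hN4 N
  have h4 : 2 ^ N ^ 4 ≤ 2 ^ (4 * N + 1 + 4 * N * N) := by
    rw [pow_add]
    exact h2.trans (Nat.mul_le_mul hN4' (hlcm.trans h3))
  have h5 : N ^ 4 ≤ 4 * N + 1 + 4 * N * N := (Nat.pow_le_pow_iff_right (by norm_num)).1 h4
  nlinarith [Nat.mul_le_mul hN hN, Nat.mul_le_mul (Nat.mul_le_mul hN hN) (Nat.le_refl (N * N))]

/-! ### The linear algebra of occurrence counts

For words `u` and `x` the coordinates `0, …, |u|` stand for the prefixes of `u` and the coordinates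
`|u| + 1, …, |u| + |x| + 1` for those of `x`; a word `y` gives the vector of the numbers of its
occurrences in these prefixes. -/

section LinearAlgebra

variable (u x : List ℕ)

/-- The letter between the prefixes number `c` and `c + 1`, if they are prefixes of one word. -/
def letterAt (c : ℕ) : Option ℕ :=
  if c < u.length then u[c]? else if c = u.length then none else x[c - u.length - 1]?

/-- The number of occurrences of `y` in the prefix number `c`. -/
def prefixCount (y : List ℕ) (c : ℕ) : ℕ :=
  if c ≤ u.length then wordBinom (u.take c) y
  else if c < u.length + x.length + 2 then wordBinom (x.take (c - u.length - 1)) y else 0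

theorem wordBinom_take_succ {u : List ℕ} {c b : ℕ} (h : u[c]? = some b) (y : List ℕ) (a : ℕ) :
    wordBinom (u.take (c + 1)) (y ++ [a]) =
      wordBinom (u.take c) (y ++ [a]) + if b = a then wordBinom (u.take c) y else 0 := by
  rw [List.take_add_one, h]
  exact wordBinom_concat_concat _ _ _ _

theorem prefixCount_concat_zero (y : List ℕ) (a : ℕ) : prefixCount u x (y ++ [a]) 0 = 0 := by
  simp [prefixCount, wordBinom_nil_concat]

theorem prefixCount_concat_succ (y : List ℕ) (a c : ℕ) :
    prefixCount u x (y ++ [a]) (c + 1) = match letterAt u x c with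
      | none => 0
      | some b => prefixCount u x (y ++ [a]) c + if b = a then prefixCount u x y c else 0 := by
  unfold letterAt
  rcases lt_trichotomy c u.length with h | h | h
  · have hc : u[c]? = some u[c] := List.getElem?_eq_getElem h
    rw [if_pos h, hc]
    simp only [prefixCount, if_pos (show c + 1 ≤ u.length from h), if_pos h.le]
    exact wordBinom_take_succ hc y a
  · subst h
    simp [prefixCount, wordBinom_nil_concat]
  · obtain ⟨e, rfl⟩ : ∃ e, c = u.length + 1 + e := ⟨c - u.length - 1, by omega⟩
    rw [if_neg (by omega), if_neg (by omega)]
    have h1 : u.length + 1 + e - u.length - 1 = e := by omega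
    have h2 : u.length + 1 + e + 1 - u.length - 1 = e + 1 := by omega
    simp only [prefixCount, h1, h2, if_neg (show ¬ u.length + 1 + e ≤ u.length by omega),
      if_neg (show ¬ u.length + 1 + e + 1 ≤ u.length by omega)]
    by_cases he : e < x.length
    · have hc : x[e]? = some x[e] := List.getElem?_eq_getElem he
      simp only [hc, if_pos (show u.length + 1 + e + 1 < u.length + x.length + 2 by omega),
        if_pos (show u.length + 1 + e < u.length + x.length + 2 by omega)]
      exact wordBinom_take_succ hc y a
    · rw [List.getElem?_eq_none (by omega), if_neg (by omega)]

variable (R : Type) [CommRing R]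

/-- The vector of the numbers of occurrences of `y`. -/
def countVec (y : List ℕ) : ℕ → R := fun c => prefixCount u x y c

/-- Auxiliary function for `extend`. -/
def extendFun (a : ℕ) (v : ℕ → R) : ℕ → R
  | 0 => 0
  | c + 1 => match letterAt u x c with
      | none => 0
      | some b => extendFun a v c + if b = a then v c else 0

/-- The linear map that takes the vector of every word `y` to that of `y` followed by `a`. -/
def extend (a : ℕ) : (ℕ → R) →ₗ[R] (ℕ → R) where
  toFun := extendFun u x R a
  map_add' v w := by
    funext c
    induction c with
    | zero => simp [extendFun]
    | succ c ih =>
      simp only [extendFun, Pi.add_apply] at ih ⊢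
      cases letterAt u x c with
      | none => simp
      | some b => simp only [ih]; split_ifs <;> ring
  map_smul' r v := by
    funext c
    induction c with
    | zero => simp [extendFun]
    | succ c ih =>
      simp only [extendFun, Pi.smul_apply, smul_eq_mul, RingHom.id_apply] at ih ⊢
      cases letterAt u x c with
      | none => simp
      | some b => simp only [ih]; split_ifs <;> ring

theorem extend_zero (a : ℕ) (v : ℕ → R) : extend u x R a v 0 = 0 := rfl

theorem extend_succ (a : ℕ) (v : ℕ → R) (c : ℕ) :
    extend u x R a v (c + 1) = match letterAt u x c with
      | none => 0
      | some b => extend u x R a v c + if b = a then v c else 0 := rfl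

theorem extend_countVec (a : ℕ) (y : List ℕ) :
    extend u x R a (countVec u x R y) = countVec u x R (y ++ [a]) := by
  funext c
  induction c with
  | zero => simp [extend_zero, countVec, prefixCount_concat_zero]
  | succ c ih =>
    rw [extend_succ, ih]
    simp only [countVec, prefixCount_concat_succ]
    cases letterAt u x c with
    | none => simp
    | some b => simp only; split_ifs <;> simp

theorem extend_eq_zero {a : ℕ} (hu : a ∉ u) (hx : a ∉ x) (v : ℕ → R) :
    extend u x R a v = 0 := by
  funext c
  induction c with
  | zero => rfl
  | succ c ih =>
    have hl : letterAt u x c ≠ some a := fun h => by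
      unfold letterAt at h
      split_ifs at h
      · exact hu (List.mem_of_getElem? h)
      · exact hx (List.mem_of_getElem? h)
    rw [extend_succ, ih]
    cases hb : letterAt u x c with
    | none => rfl
    | some b =>
      have : b ≠ a := fun h => hl (h ▸ hb)
      simp [this]

/-- The difference of the entries for the whole words `u` and `x`. -/
def gap : (ℕ → R) →ₗ[R] R :=
  (LinearMap.proj u.length : (ℕ → R) →ₗ[R] R) -
    (LinearMap.proj (u.length + x.length + 1) : (ℕ → R) →ₗ[R] R)

theorem gap_apply (v : ℕ → R) :
    gap u x R v = v u.length - v (u.length + x.length + 1) := rfl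

theorem gap_countVec (y : List ℕ) :
    gap u x R (countVec u x R y) = (wordBinom u y : R) - (wordBinom x y : R) := by
  have h1 : prefixCount u x y u.length = wordBinom u y := by simp [prefixCount]
  have h2 : prefixCount u x y (u.length + x.length + 1) = wordBinom x y := by
    have h : u.length + x.length + 1 - u.length - 1 = x.length := by omega
    rw [prefixCount, if_neg (by omega), if_pos (by omega), h, List.take_length]
  simp only [gap_apply, countVec, h1, h2]

/-- The span of the vectors of the words of length `j`. -/
def layer (j : ℕ) : Submodule R (ℕ → R) :=
  Submodule.span R (countVec u x R '' {y | y.length = j})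

theorem extend_mem_layer {j a : ℕ} {v : ℕ → R} (hv : v ∈ layer u x R j) :
    extend u x R a v ∈ layer u x R (j + 1) := by
  suffices h : layer u x R j ≤ (layer u x R (j + 1)).comap (extend u x R a) from h hv
  refine Submodule.span_le.2 ?_
  rintro _ ⟨y, hy, rfl⟩
  refine Submodule.subset_span ⟨y ++ [a], ?_, (extend_countVec u x R a y).symm⟩
  simpa using hy

theorem exists_wordBinom_ne {j : ℕ} {v : ℕ → R} (hv : v ∈ layer u x R j)
    (hg : gap u x R v ≠ 0) : ∃ y : List ℕ, y.length = j ∧ wordBinom u y ≠ wordBinom x y := by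
  by_contra! hcon
  refine hg ?_
  suffices h : layer u x R j ≤ LinearMap.ker (gap u x R) from h hv
  refine Submodule.span_le.2 ?_
  rintro _ ⟨y, hy, rfl⟩
  simp [gap_countVec, hcon y hy]

end LinearAlgebra

/-! ### Elimination modulo `m` -/

section Elimination

/-- The first `d` entries of a sequence of numbers, as a vector modulo `m`. -/
def modVec (m d : ℕ) (f : ℕ → ℕ) : ℕ → ZMod m := fun c => if c < d then (f c : ZMod m) else 0

theorem modVec_congr {m d : ℕ} {f g : ℕ → ℕ} (h : ∀ c < d, f c = g c) :
    modVec m d f = modVec m d g := by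
  funext c
  unfold modVec
  split_ifs with hc
  · rw [h c hc]
  · rfl

theorem modVec_eq_zero {m d : ℕ} {f : ℕ → ℕ} (h : ∀ c < d, f c = 0) : modVec m d f = 0 := by
  funext c
  unfold modVec
  split_ifs with hc
  · simp [h c hc]
  · rfl

/-- The first `d` rows of `T` are reduced modulo `m`, and in echelon form: the entries of row `p`
before the diagonal vanish, and the whole row vanishes if its entry on the diagonal does. -/
def Echelon (m d : ℕ) (T : ℕ → ℕ → ℕ) : Prop :=
  ∀ p < d, (∀ j < d, T p j < m) ∧ (∀ j < p, T p j = 0) ∧ (T p p = 0 → ∀ j < d, T p j = 0)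

theorem Echelon.congr {m d : ℕ} {T T' : ℕ → ℕ → ℕ} (hT : Echelon m d T)
    (h : ∀ p < d, ∀ j < d, T' p j = T p j) : Echelon m d T' := by
  intro p hp
  obtain ⟨h1, h2, h3⟩ := hT p hp
  refine ⟨fun j hj => h p hp j hj ▸ h1 j hj, fun j hj => ?_, fun h0 j hj => ?_⟩
  · rw [h p hp j (hj.trans hp), h2 j hj]
  · rw [h p hp p hp] at h0
    rw [h p hp j hj, h3 h0 j hj]

/-- All rows of `T` lie in `S`. -/
def RowsIn {m : ℕ} (d : ℕ) (T : ℕ → ℕ → ℕ) (S : Submodule (ZMod m) (ℕ → ZMod m)) : Prop :=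
  ∀ i < d, modVec m d (T i) ∈ S

theorem RowsIn.congr {m d : ℕ} {T T' : ℕ → ℕ → ℕ} {S : Submodule (ZMod m) (ℕ → ZMod m)}
    (hT : RowsIn d T S) (h : ∀ p < d, ∀ j < d, T' p j = T p j) : RowsIn d T' S :=
  fun i hi => modVec_congr (h i hi) ▸ hT i hi

/-- The span of the rows of `T`. -/
def rowSpan (m d : ℕ) (T : ℕ → ℕ → ℕ) : Submodule (ZMod m) (ℕ → ZMod m) :=
  Submodule.span (ZMod m) {v | ∃ i < d, v = modVec m d (T i)}

theorem rowsIn_rowSpan (m d : ℕ) (T : ℕ → ℕ → ℕ) : RowsIn d T (rowSpan m d T) :=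
  fun i hi => Submodule.subset_span ⟨i, hi, rfl⟩

theorem rowSpan_le {m d : ℕ} {T : ℕ → ℕ → ℕ} {S : Submodule (ZMod m) (ℕ → ZMod m)}
    (h : RowsIn d T S) : rowSpan m d T ≤ S := by
  refine Submodule.span_le.2 ?_
  rintro _ ⟨i, hi, rfl⟩
  exact h i hi

theorem rowSpan_congr {m d : ℕ} {T T' : ℕ → ℕ → ℕ} (h : ∀ p < d, ∀ j < d, T' p j = T p j) :
    rowSpan m d T' = rowSpan m d T :=
  le_antisymm (rowSpan_le ((rowsIn_rowSpan m d T).congr h))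
    (rowSpan_le ((rowsIn_rowSpan m d T').congr fun p hp j hj => (h p hp j hj).symm))

/-- The state of the insertion of `v₀` into the table `T₀` after the elimination of the entries
before `p`. -/
structure Insertion (m d : ℕ) (T₀ : ℕ → ℕ → ℕ) (v₀ : ℕ → ℕ) (p : ℕ) (T : ℕ → ℕ → ℕ) (v : ℕ → ℕ) :
    Prop where
  echelon : Echelon m d T
  lt : ∀ j < d, v j < m
  eq_zero : ∀ j < p, j < d → v j = 0
  fwd : ∀ S : Submodule (ZMod m) (ℕ → ZMod m), RowsIn d T₀ S → modVec m d v₀ ∈ S →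
    RowsIn d T S ∧ modVec m d v ∈ S
  bwd : m.Prime → ∀ S : Submodule (ZMod m) (ℕ → ZMod m), RowsIn d T S → modVec m d v ∈ S →
    RowsIn d T₀ S ∧ modVec m d v₀ ∈ S

theorem Insertion.start {m d : ℕ} {T : ℕ → ℕ → ℕ} {v : ℕ → ℕ} (hT : Echelon m d T)
    (hv : ∀ j < d, v j < m) : Insertion m d T v 0 T v :=
  ⟨hT, hv, fun _ h => absurd h (by omega), fun _ h h' => ⟨h, h'⟩, fun _ _ h h' => ⟨h, h'⟩⟩

theorem Insertion.next_of_eq_zero {m d p : ℕ} {T₀ T : ℕ → ℕ → ℕ} {v₀ v : ℕ → ℕ}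
    (h : Insertion m d T₀ v₀ p T v) (hp : v p = 0) : Insertion m d T₀ v₀ (p + 1) T v :=
  { h with
    eq_zero := fun j hj hd => by
      rcases Nat.lt_succ_iff_lt_or_eq.1 hj with hj | rfl
      · exact h.eq_zero j hj hd
      · exact hp }

/-- Put the vector `v` into row `p` if the row is empty. -/
theorem Insertion.fill {m d p : ℕ} {T₀ T T' : ℕ → ℕ → ℕ} {v₀ v : ℕ → ℕ}
    (h : Insertion m d T₀ v₀ p T v) (hp : p < d) (hvp : v p ≠ 0) (h0 : T p p = 0)
    (hT' : ∀ i < d, i ≠ p → ∀ j < d, T' i j = T i j) (hTp : ∀ j < d, T' p j = v j) :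
    Insertion m d T₀ v₀ p T' v := by
  have hrow : ∀ i < d, i ≠ p → modVec m d (T' i) = modVec m d (T i) := fun i hi hip =>
    modVec_congr (hT' i hi hip)
  have hrowp : modVec m d (T' p) = modVec m d v := modVec_congr hTp
  refine ⟨fun i hi => ?_, h.lt, h.eq_zero, fun S hS hv => ?_, fun hm S hS hv => ?_⟩
  · by_cases hip : i = p
    · subst hip
      refine ⟨fun j hj => hTp j hj ▸ h.lt j hj, fun j hj => ?_, fun hz => ?_⟩
      · rw [hTp j (hj.trans hi), h.eq_zero j hj (hj.trans hi)]
      · exact absurd ((hTp i hi).symm.trans hz) hvp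
    · obtain ⟨h1, h2, h3⟩ := h.echelon i hi
      refine ⟨fun j hj => hT' i hi hip j hj ▸ h1 j hj, fun j hj => ?_, fun hz j hj => ?_⟩
      · rw [hT' i hi hip j (hj.trans hi), h2 j hj]
      · rw [hT' i hi hip i hi] at hz
        rw [hT' i hi hip j hj, h3 hz j hj]
  · obtain ⟨h1, h2⟩ := h.fwd S hS hv
    refine ⟨fun i hi => ?_, h2⟩
    by_cases hip : i = p
    · subst hip; rw [hrowp]; exact h2
    · rw [hrow i hi hip]; exact h1 i hi
  · refine h.bwd hm S (fun i hi => ?_) hv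
    by_cases hip : i = p
    · subst hip
      rw [modVec_eq_zero ((h.echelon i hi).2.2 h0)]
      exact S.zero_mem
    · rw [← hrow i hi hip]; exact hS i hi

/-- Eliminate the entry `p` of `v` by means of row `p`. -/
theorem Insertion.reduce {m d p : ℕ} {T₀ T : ℕ → ℕ → ℕ} {v₀ v v' : ℕ → ℕ}
    (h : Insertion m d T₀ v₀ p T v) (hm0 : 0 < m) (hp : p < d) (hTp : T p p ≠ 0)
    (hv' : ∀ j < d, v' j = (T p p * v j + (m - v p) * T p j) % m) :
    Insertion m d T₀ v₀ (p + 1) T v' := by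
  have hvp := h.lt p hp
  have hvec : modVec m d v' =
      (T p p : ZMod m) • modVec m d v - (v p : ZMod m) • modVec m d (T p) := by
    funext c
    simp only [modVec, Pi.sub_apply, Pi.smul_apply, smul_eq_mul]
    split_ifs with hc
    · rw [hv' c hc, ZMod.natCast_mod]
      push_cast [hvp.le]
      simp
      ring
    · simp
  refine ⟨h.echelon, fun j hj => ?_, fun j hj hjd => ?_, fun S hS hv => ?_, fun hm S hS hv => ?_⟩
  · rw [hv' j hj]; exact Nat.mod_lt _ hm0
  · rw [hv' j hjd]
    rcases Nat.lt_succ_iff_lt_or_eq.1 hj with hj | rfl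
    · rw [h.eq_zero j hj hjd, (h.echelon p hp).2.1 j hj]; simp
    · have : T j j * v j + (m - v j) * T j j = m * T j j := by
        rw [mul_comm (T j j), ← add_mul]
        congr 1
        omega
      rw [this]; simp
  · obtain ⟨h1, h2⟩ := h.fwd S hS hv
    refine ⟨h1, ?_⟩
    rw [hvec]
    exact S.sub_mem (S.smul_mem _ h2) (S.smul_mem _ (h1 p hp))
  · have := Fact.mk hm
    refine h.bwd hm S hS ?_
    have hne : (T p p : ZMod m) ≠ 0 := fun h0 => by
      rw [ZMod.natCast_eq_zero_iff] at h0
      exact (Nat.le_of_dvd (Nat.pos_of_ne_zero hTp) h0).not_gt ((h.echelon p hp).1 p hp)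
    have : modVec m d v = (T p p : ZMod m)⁻¹ •
        (modVec m d v' + (v p : ZMod m) • modVec m d (T p)) := by
      rw [hvec, sub_add_cancel, smul_smul, inv_mul_cancel₀ hne, one_smul]
    rw [this]
    exact S.smul_mem _ (S.add_mem hv (S.smul_mem _ (hS p hp)))

theorem Insertion.mem_rowSpan {m d : ℕ} {T₀ T : ℕ → ℕ → ℕ} {v₀ v : ℕ → ℕ}
    (h : Insertion m d T₀ v₀ d T v) (hm : m.Prime) :
    rowSpan m d T₀ ≤ rowSpan m d T ∧ modVec m d v₀ ∈ rowSpan m d T := by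
  have h0 : modVec m d v = 0 := modVec_eq_zero fun c hc => h.eq_zero c hc hc
  obtain ⟨h1, h2⟩ := h.bwd hm (rowSpan m d T) (rowsIn_rowSpan m d T)
    (h0 ▸ Submodule.zero_mem _)
  exact ⟨rowSpan_le h1, h2⟩

end Elimination

section Rounds

variable {u x : List ℕ} {m d : ℕ}

/-- A vector that is computed modulo `m` by the recursion for `extend`. -/
theorem modVec_eq_extend (hd : d = u.length + x.length + 2) {a : ℕ} {f v : ℕ → ℕ} (h0 : v 0 = 0)
    (hs : ∀ c, c + 1 < d → v (c + 1) = match letterAt u x c with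
      | none => 0
      | some b => (v c + (if b = a then 1 else 0) * f c) % m) :
    modVec m d v = extend u x (ZMod m) a (modVec m d f) := by
  funext c
  induction c with
  | zero => simp [modVec, h0, extend_zero]
  | succ c ih =>
    rw [extend_succ, ← ih]
    by_cases hc : c + 1 < d
    · have hc' : c < d := by omega
      simp only [modVec, if_pos hc, if_pos hc', hs c hc]
      cases letterAt u x c with
      | none => simp
      | some b => by_cases hb : b = a <;> simp [hb]
    · have : letterAt u x c = none := by
        rw [letterAt, if_neg (by omega), if_neg (by omega), List.getElem?_eq_none (by omega)]
      simp [modVec, hc, this]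

/-- The table `T` is in echelon form, its rows lie in the span of the vectors of the words of
length `j`, and span it if `m` is prime. -/
structure SpansLayer (u x : List ℕ) (m d j : ℕ) (T : ℕ → ℕ → ℕ) : Prop where
  echelon : Echelon m d T
  rows : RowsIn d T (layer u x (ZMod m) j)
  span : m.Prime → ∀ y : List ℕ, y.length = j → countVec u x (ZMod m) y ∈ rowSpan m d T

theorem SpansLayer.congr {j : ℕ} {T T' : ℕ → ℕ → ℕ} (hT : SpansLayer u x m d j T)
    (h : ∀ p < d, ∀ c < d, T' p c = T p c) : SpansLayer u x m d j T' :=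
  ⟨hT.echelon.congr h, hT.rows.congr h, fun hm y hy => rowSpan_congr h ▸ hT.span hm y hy⟩

theorem spansLayer_zero (hd : d = u.length + x.length + 2) (hm : 2 ≤ m) {T : ℕ → ℕ → ℕ}
    (hT : ∀ p < d, ∀ c < d, T p c = if p = 0 then 1 else 0) : SpansLayer u x m d 0 T := by
  have h0 : modVec m d (T 0) = countVec u x (ZMod m) [] := by
    funext c
    simp only [modVec, countVec, prefixCount, wordBinom_nil_right]
    by_cases hc : c < d
    · rw [if_pos hc, hT 0 (by omega) c hc]
      split_ifs <;> first | rfl | omega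
    · rw [if_neg hc, if_neg (by omega), if_neg (by omega)]
      simp
  refine ⟨fun p hp => ⟨fun j hj => ?_, fun j hj => ?_, fun hz j hj => ?_⟩, fun i hi => ?_,
    fun _ y hy => ?_⟩
  · rw [hT p hp j hj]; split_ifs <;> omega
  · rw [hT p hp j (hj.trans hp), if_neg (by omega)]
  · rw [hT p hp p hp] at hz
    rw [hT p hp j hj, hz]
  · by_cases h : i = 0
    · subst h
      rw [h0]
      exact Submodule.subset_span ⟨[], rfl, rfl⟩
    · rw [modVec_eq_zero fun c hc => by rw [hT i hi c hc, if_neg h]]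
      exact Submodule.zero_mem _
  · rw [List.length_eq_zero_iff.1 hy, ← h0]
    exact rowsIn_rowSpan m d T 0 (by omega)

/-- The state of the computation of the table `T'` for words of length `j + 1` from the table `T`
for words of length `j`, when the pairs of a row of `T` and a letter `inp q` that satisfy `done`
have been dealt with. The number `bad` is not zero if a difference between `u` and `x` has been
found; `H` is what is known if none has been found before. -/
structure RoundState (u x : List ℕ) (m d k j : ℕ) (inp : ℕ → ℕ) (T T' : ℕ → ℕ → ℕ) (bad : ℕ)
    (H : Prop) (done : ℕ → ℕ → Prop) : Prop where
  echelon : Echelon m d T'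
  rows : RowsIn d T' (layer u x (ZMod m) (j + 1))
  sound : bad ≠ 0 → ¬ BinomEquiv k u x
  hist : bad = 0 → H
  span : m.Prime → ∀ r q, done r q →
    extend u x (ZMod m) (inp q) (modVec m d (T r)) ∈ rowSpan m d T' ∧
      (bad = 0 → gap u x (ZMod m) (extend u x (ZMod m) (inp q) (modVec m d (T r))) = 0)

theorem RoundState.mono {k j bad : ℕ} {inp : ℕ → ℕ} {T T' : ℕ → ℕ → ℕ} {H : Prop}
    {done done' : ℕ → ℕ → Prop} (h : RoundState u x m d k j inp T T' bad H done)
    (hd : ∀ r q, done' r q → done r q) : RoundState u x m d k j inp T T' bad H done' :=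
  { h with span := fun hm r q hrq => h.span hm r q (hd r q hrq) }

theorem RoundState.start {k j bad : ℕ} {inp : ℕ → ℕ} {T T' : ℕ → ℕ → ℕ} {H : Prop}
    {done : ℕ → ℕ → Prop} (hm : 0 < m) (hT' : ∀ p < d, ∀ c < d, T' p c = 0)
    (hs : bad ≠ 0 → ¬ BinomEquiv k u x) (hH : bad = 0 → H) (hdone : ∀ r q, ¬ done r q) :
    RoundState u x m d k j inp T T' bad H done :=
  ⟨fun p hp => ⟨fun c hc => hT' p hp c hc ▸ hm, fun c hc => hT' p hp c (hc.trans hp),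
      fun _ c hc => hT' p hp c hc⟩,
    fun i hi => modVec_eq_zero (m := m) (hT' i hi) ▸ Submodule.zero_mem _,
    hs, hH, fun _ r q h => absurd h (hdone r q)⟩

theorem RoundState.insert {k j bad bad' r q : ℕ} {inp : ℕ → ℕ} {T T' T'' : ℕ → ℕ → ℕ}
    {v v' : ℕ → ℕ} {H : Prop} {done : ℕ → ℕ → Prop} (hd : d = u.length + x.length + 2)
    (h : RoundState u x m d k j inp T T' bad H done) (hT : RowsIn d T (layer u x (ZMod m) j))
    (hr : r < d) (hj : j < k) (hlt : ∀ c < d, v c < m)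
    (hv : modVec m d v = extend u x (ZMod m) (inp q) (modVec m d (T r)))
    (hins : Insertion m d T' v d T'' v')
    (hbad : bad' = if v u.length = v (d - 1) then bad else 1) :
    RoundState u x m d k j inp T T'' bad' H (fun r' q' => done r' q' ∨ (r' = r ∧ q' = q)) := by
  have hlayer : modVec m d v ∈ layer u x (ZMod m) (j + 1) := by
    rw [hv]; exact extend_mem_layer u x _ (hT r hr)
  have hgap : gap u x (ZMod m) (modVec m d v) = 0 ↔ v u.length = v (d - 1) := by
    have h1 : d - 1 = u.length + x.length + 1 := by omega
    rw [gap_apply, sub_eq_zero, ← h1, modVec, modVec, if_pos (by omega), if_pos (by omega),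
      ZMod.natCast_eq_natCast_iff', Nat.mod_eq_of_lt (hlt _ (by omega)),
      Nat.mod_eq_of_lt (hlt _ (by omega))]
  have hb0 : bad' = 0 → bad = 0 ∧ v u.length = v (d - 1) := by
    rw [hbad]; split_ifs with hc
    · exact fun h => ⟨h, hc⟩
    · exact False.elim
  refine ⟨hins.echelon, (hins.fwd _ h.rows hlayer).1, fun hb => ?_, fun hb => h.hist (hb0 hb).1,
    fun hm r' q' hrq => ?_⟩
  · by_cases hc : v u.length = v (d - 1)
    · rw [hbad, if_pos hc] at hb
      exact h.sound hb
    · obtain ⟨y, hy, hne⟩ := exists_wordBinom_ne u x _ hlayer (fun h0 => hc (hgap.1 h0))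
      exact fun heq => hne (heq y (by omega))
  · obtain ⟨h1, h2⟩ := hins.mem_rowSpan hm
    rcases hrq with hrq | ⟨rfl, rfl⟩
    · obtain ⟨h3, h4⟩ := h.span hm r' q' hrq
      exact ⟨h1 h3, fun hb => h4 (hb0 hb).1⟩
    · rw [← hv]
      exact ⟨h2, fun hb => hgap.2 (hb0 hb).2⟩

theorem RoundState.finish {k j N bad : ℕ} {inp : ℕ → ℕ} {T T' : ℕ → ℕ → ℕ} {H : Prop}
    (h : RoundState u x m d k j inp T T' bad H (fun r q => r < d ∧ q < N))
    (hT : SpansLayer u x m d j T) (hinp : ∀ a, a ∈ u ∨ a ∈ x → ∃ q < N, inp q = a) :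
    SpansLayer u x m d (j + 1) T' ∧ (m.Prime → bad = 0 → ∀ y : List ℕ, y.length = j + 1 →
      gap u x (ZMod m) (countVec u x (ZMod m) y) = 0) := by
  have key : m.Prime → ∀ y : List ℕ, y.length = j + 1 →
      countVec u x (ZMod m) y ∈ rowSpan m d T' ∧
        (bad = 0 → gap u x (ZMod m) (countVec u x (ZMod m) y) = 0) := by
    intro hm y hy
    obtain ⟨y', a, rfl⟩ : ∃ y' a, y = y' ++ [a] :=
      ⟨y.dropLast, y.getLast (by rintro rfl; simp at hy), (List.dropLast_append_getLast _).symm⟩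
    rw [← extend_countVec]
    have hy' := hT.span hm y' (by simpa using hy)
    by_cases ha : a ∈ u ∨ a ∈ x
    · obtain ⟨q, hq, rfl⟩ := hinp a ha
      refine ⟨?_, fun hb => ?_⟩
      · suffices hle : rowSpan m d T ≤ (rowSpan m d T').comap (extend u x (ZMod m) (inp q)) from
          hle hy'
        exact rowSpan_le fun r hr => (h.span hm r q ⟨hr, hq⟩).1
      · suffices hle : rowSpan m d T ≤
            (LinearMap.ker (gap u x (ZMod m))).comap (extend u x (ZMod m) (inp q)) from hle hy'
        exact rowSpan_le fun r hr => (h.span hm r q ⟨hr, hq⟩).2 hb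
    · rw [not_or] at ha
      rw [extend_eq_zero u x _ ha.1 ha.2]
      exact ⟨Submodule.zero_mem _, fun _ => map_zero _⟩
  exact ⟨⟨h.echelon, h.rows, fun hm y hy => (key hm y hy).1⟩,
    fun hm hb y hy => (key hm y hy).2 hb⟩

end Rounds

/-! ### The matching program -/

namespace WordRAM

/-- The variables of the matching program. -/
inductive Var where
  | out | n | lx | N | kb | k | nn | t | i | l | d | bad | lim | m₀ | m | rnd | r | q | a
  | p | j | b | c | base | off | len
  deriving DecidableEq

namespace Var

/-- The register of a variable. -/
def idx (x : Var) : ℕ := x.ctorIdx + 1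

theorem idx_isLayout : IsLayout idx 27 where
  inj := by
    have h : ∀ x : Var, [out, n, lx, N, kb, k, nn, t, i, l, d, bad, lim, m₀, m, rnd, r, q, a, p, j,
        b, c, base, off, len][x.idx - 1]? = some x := by
      intro x; cases x <;> rfl
    intro x y hxy
    have := h x
    rw [hxy, h y] at this
    exact (Option.some.inj this).symm
  pos x := Nat.succ_pos _
  lt x := by cases x <;> decide

end Var

instance : Coe Var (Ex Var) := ⟨Ex.var⟩

local infixl:65 " +ₑ " => Ex.op BinOp.add
local infixl:65 " -ₑ " => Ex.op BinOp.sub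
local infixl:70 " *ₑ " => Ex.op BinOp.mul
local infixl:70 " /ₑ " => Ex.op BinOp.div
local infixl:70 " %ₑ " => Ex.op BinOp.rem
local infix:50 " =ₑ " => Ex.op BinOp.eq
local infix:50 " <ₑ " => Ex.op BinOp.lt
local infixr:40 " ;; " => Cmd.seq

/-- The row of the memory that holds the vector under consideration. -/
abbrev vecRow : Ex Var := .lit 2

/-- The row of the memory that holds row `e` of the current table. -/
abbrev oldRow (e : Ex Var) : Ex Var := .lit 3 +ₑ .lit 2 *ₑ e

/-- The row of the memory that holds row `e` of the next table. -/
abbrev newRow (e : Ex Var) : Ex Var := .lit 4 +ₑ .lit 2 *ₑ e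

/-- The bounds that keep all values of the matching program below `M`. -/
structure Bounds (M D N : ℕ) : Prop where
  three_le : 3 ≤ N
  le_dim : N * N + N * N + N + N ≤ D
  addr_lt : (2 * N + 5) * D ≤ M
  sq_lt : 3 * (D + 2) * (D + 2) ≤ M

theorem Bounds.row {M D N : ℕ} (h : Bounds M D N) {r c : ℕ} (hr : r ≤ 2 * N + 4) (hc : c < D) :
    r * D + c < M := by
  have h1 : r * D ≤ (2 * N + 4) * D := Nat.mul_le_mul_right D hr
  have h2 := h.addr_lt
  have h3 : (2 * N + 5) * D = (2 * N + 4) * D + D := by ring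
  omega

theorem Bounds.lin {M D N : ℕ} (h : Bounds M D N) : 3 * D + 12 ≤ M := by
  nlinarith [h.sq_lt]

attribute [local simp] Cmd.wp Ex.Ok Ex.eval BinOp.natEval BinOp.Safe BinOp.eval

/-- A loop that fills the beginning of a row of the memory. -/
theorem wp_loop_store {V : Type} [DecidableEq V] {M D : ℕ} {x y : V} {re e : Ex V} {σ : St V}
    {Q : St V → Prop} (R : ℕ) (g : ℕ → ℕ) (hxy : x ≠ y) (hD : σ.var y ≤ D)
    (hstep : ∀ j < σ.var y, ∀ τ : St V, (∀ z, z ≠ x → τ.var z = σ.var z) → τ.var x = j →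
      (∀ s, s ≠ R → τ.mem s = σ.mem s) → (∀ i, j ≤ i → τ.mem R i = σ.mem R i) →
      re.Ok M D τ ∧ re.eval D τ = R ∧ R * D + j < M ∧ e.Ok M D τ ∧ e.eval D τ = g j)
    (hQ : ∀ τ : St V, (∀ z, z ≠ x → τ.var z = σ.var z) → (∀ s, s ≠ R → τ.mem s = σ.mem s) →
      (∀ i < σ.var y, τ.mem R i = g i) → (∀ i, σ.var y ≤ i → τ.mem R i = σ.mem R i) → Q τ) :
    (Cmd.loop x y (.store re (.var x) e)).wp M D Q σ := by
  refine Cmd.wp_loop (fun j τ => (∀ s, s ≠ R → τ.mem s = σ.mem s) ∧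
      (∀ i < j, τ.mem R i = g i) ∧ (∀ i, j ≤ i → τ.mem R i = σ.mem R i))
    hxy (by simp [Cmd.writes]) (by simp [Cmd.writes]) hD ⟨fun _ _ => rfl, by simp, fun _ _ => rfl⟩
    ?_ ?_
  · rintro j τ hj hfr ⟨h1, h2, h3⟩
    obtain ⟨k1, k2, k3, k4, k5⟩ := hstep j hj (τ.set x j)
      (fun z hz => by rw [St.var_set, if_neg hz]; exact hfr z (by simp [Cmd.writes, hz]))
      (by simp) h1 h3
    simp only [Cmd.wp, Ex.Ok, Ex.eval, k2, k5, St.var_set, if_true]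
    refine ⟨⟨k1, trivial, by omega, k3⟩, k4, fun s hs => ?_, fun i hi => ?_, fun i hi => ?_⟩
    · rw [St.mem_write_row _ _ _ hs]; exact h1 s hs
    · rw [St.mem_write]
      split_ifs with h
      · rw [h.2]
      · exact h2 i (by omega)
    · rw [St.mem_write, if_neg (by omega)]
      exact h3 i (by omega)
  · rintro τ hfr ⟨h1, h2, h3⟩
    exact hQ _ (fun z hz => by rw [St.var_set, if_neg hz]; exact hfr z (by simp [Cmd.writes, hz]))
      h1 h2 h3

/-- Continue with one of the two words the computation of the vector of a word extended by the
letter `a`, from row `r` of the current table. -/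
def extendCmd : Cmd Var :=
  .store vecRow Var.off (.lit 0) ;;
  .loop Var.c Var.len
    (.store vecRow (Var.off +ₑ Var.c +ₑ .lit 1)
      ((.load vecRow (Var.off +ₑ Var.c) +ₑ
        (.load (.lit 0) (Var.base +ₑ Var.c) =ₑ Var.a) *ₑ
          .load (oldRow Var.r) (Var.off +ₑ Var.c)) %ₑ Var.m))

theorem wp_extendCmd {M D N : ℕ} (hB : Bounds M D N) {σ : St Var} {Q : St Var → Prop}
    (hm : 0 < σ.var .m) (hmD : σ.var .m ≤ D + 1) (hr : σ.var .r < N)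
    (hoff : σ.var .off + σ.var .len < N) (hbase : σ.var .base + σ.var .len ≤ N)
    (hT : ∀ c < σ.var .len, σ.mem (3 + 2 * σ.var .r) (σ.var .off + c) < σ.var .m)
    (hQ : ∀ τ : St Var, (∀ z, z ∉ extendCmd.writes → τ.var z = σ.var z) →
      (∀ s, s ≠ 2 → τ.mem s = σ.mem s) → τ.mem 2 (σ.var .off) = 0 →
      (∀ c < σ.var .len, τ.mem 2 (σ.var .off + c + 1) = (τ.mem 2 (σ.var .off + c) +
        (if σ.mem 0 (σ.var .base + c) = σ.var .a then 1 else 0) *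
          σ.mem (3 + 2 * σ.var .r) (σ.var .off + c)) % σ.var .m) →
      (∀ j, j < σ.var .off ∨ σ.var .off + σ.var .len < j → τ.mem 2 j = σ.mem 2 j) → Q τ) :
    extendCmd.wp M D Q σ := by
  have hlin := hB.lin
  have hND := hB.le_dim
  have hN3 := hB.three_le
  simp only [extendCmd, Cmd.wp, Ex.Ok, Ex.eval]
  refine ⟨⟨by omega, trivial, by omega, hB.row (by omega) (by omega)⟩, by omega, ?_⟩
  refine Cmd.wp_loop (fun j τ => (∀ s, s ≠ 2 → τ.mem s = σ.mem s) ∧ τ.mem 2 (σ.var .off) = 0 ∧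
      (∀ c < j, τ.mem 2 (σ.var .off + c + 1) = (τ.mem 2 (σ.var .off + c) +
        (if σ.mem 0 (σ.var .base + c) = σ.var .a then 1 else 0) *
          σ.mem (3 + 2 * σ.var .r) (σ.var .off + c)) % σ.var .m) ∧
      τ.mem 2 (σ.var .off + j) < σ.var .m ∧
      (∀ i, i < σ.var .off ∨ σ.var .off + j < i → τ.mem 2 i = σ.mem 2 i))
    (by decide) (by decide) (by decide) ?_ ?_ ?_ ?_
  · simp only [St.var_write]; omega
  · refine ⟨fun s hs => St.mem_write_row _ _ _ hs, by simp [St.mem_write],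
      fun c hc => absurd hc (by omega), by simpa [St.mem_write] using hm, fun i hi => ?_⟩
    rw [St.mem_write, if_neg (by omega)]
  · rintro j τ hj hfr ⟨h1, h2, h3, h4, h5⟩
    have f1 : τ.var .off = σ.var .off := hfr .off (by decide)
    have f2 : τ.var .base = σ.var .base := hfr .base (by decide)
    have f3 : τ.var .r = σ.var .r := hfr .r (by decide)
    have f4 : τ.var .a = σ.var .a := hfr .a (by decide)
    have f5 : τ.var .m = σ.var .m := hfr .m (by decide)
    replace hj : j < σ.var .len := hj
    have hTj := hT j hj
    set w := (if σ.mem 0 (σ.var .base + j) = σ.var .a then 1 else 0) *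
      σ.mem (3 + 2 * σ.var .r) (σ.var .off + j) with hw
    have hwm : w < σ.var .m := by rw [hw]; split_ifs <;> omega
    simp only [Cmd.wp, Ex.Ok, Ex.eval, BinOp.natEval, BinOp.Safe, BinOp.eval, St.var_set,
      reduceCtorEq, if_false, if_true, f1, f2, f3, f4, f5, St.mem_set, h1 0 (by omega),
      h1 (3 + 2 * σ.var .r) (by omega), ← hw]
    refine ⟨?_, ?_, fun s hs => ?_, ?_, fun c hc => ?_, ?_, fun i hi => ?_⟩
    · and_intros <;> first | trivial | omega
    · and_intros <;> first | trivial | omega | exact hB.row (by omega) (by omega)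
    · rw [St.mem_write_row _ _ _ hs]; exact h1 s hs
    · rw [St.mem_write, if_neg (by omega)]; exact h2
    · rw [St.mem_write, St.mem_write, if_neg (show ¬ (2 = 2 ∧ σ.var .off + c = _) by omega)]
      by_cases hcj : c = j
      · subst hcj
        rw [if_pos ⟨rfl, rfl⟩]; rfl
      · rw [if_neg (by omega)]; exact h3 c (by omega)
    · rw [St.mem_write, if_pos ⟨rfl, by omega⟩]; exact Nat.mod_lt _ hm
    · rw [St.mem_write, if_neg (by omega)]; exact h5 i (by omega)
  · rintro τ hfr ⟨h1, h2, h3, h4, h5⟩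
    refine hQ _ (fun z hz => ?_) h1 h2 h3 h5
    rw [St.var_set, if_neg (by rintro rfl; exact hz (by decide))]
    exact hfr z hz

/-- Fill the current table with values of `e`, and the next table with zeros. -/
def tableCmd (e : Ex Var) : Cmd Var :=
  .loop Var.p Var.d
    (.loop Var.j Var.d (.store (oldRow Var.p) Var.j e) ;;
      .loop Var.j Var.d (.store (newRow Var.p) Var.j (.lit 0)))

theorem wp_tableCmd {M D N : ℕ} (hB : Bounds M D N) {e : Ex Var} {σ : St Var} {Q : St Var → Prop}
    (G : ℕ → ℕ → ℕ) (hd : σ.var .d < N)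
    (he : ∀ p < σ.var .d, ∀ j < σ.var .d, ∀ τ : St Var, τ.var .p = p → τ.var .j = j →
      (∀ i, p ≤ i → τ.mem (4 + 2 * i) = σ.mem (4 + 2 * i)) →
      e.Ok M D τ ∧ e.eval D τ = G p j)
    (hQ : ∀ τ : St Var, (∀ z, z ∉ (tableCmd e).writes → τ.var z = σ.var z) →
      (∀ s, s ≤ 2 → τ.mem s = σ.mem s) →
      (∀ p < σ.var .d, ∀ j < σ.var .d, τ.mem (3 + 2 * p) j = G p j) →
      (∀ p < σ.var .d, ∀ j < σ.var .d, τ.mem (4 + 2 * p) j = 0) → Q τ) :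
    (tableCmd e).wp M D Q σ := by
  have hlin := hB.lin
  have hND := hB.le_dim
  have hN3 := hB.three_le
  refine Cmd.wp_loop (fun i τ => (∀ s, s ≤ 2 → τ.mem s = σ.mem s) ∧
      (∀ p < i, ∀ j < σ.var .d, τ.mem (3 + 2 * p) j = G p j) ∧
      (∀ p < i, ∀ j < σ.var .d, τ.mem (4 + 2 * p) j = 0) ∧
      (∀ p, i ≤ p → τ.mem (4 + 2 * p) = σ.mem (4 + 2 * p)))
    (by decide) (by simp [Cmd.writes]) (by simp [Cmd.writes]) (by omega)
    ⟨fun _ _ => rfl, by simp, by simp, fun _ _ => rfl⟩ ?_ ?_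
  · rintro p τ hp hfr ⟨h1, h2, h3, h4⟩
    have f1 : τ.var .d = σ.var .d := hfr .d (by simp [Cmd.writes])
    refine wp_loop_store (3 + 2 * p) (G p) (by decide) (by simp [f1]; omega) ?_ ?_
    · intro j hj τ' k1 k2 k3 k4
      have kp : τ'.var .p = p := by rw [k1 .p (by decide)]; simp
      obtain ⟨e1, e2⟩ := he p hp j (by simpa [f1] using hj) τ' kp k2
        (fun i hi => (k3 _ (by omega)).trans (h4 i hi))
      replace hj : j < σ.var .d := by simpa [f1] using hj
      refine ⟨?_, by simp [kp], hB.row (by omega) (by omega), e1, e2⟩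
      simp [kp]; omega
    intro τ₁ k1 k2 k3 k4
    have g1 : τ₁.var .d = σ.var .d := by rw [k1 .d (by decide)]; simpa using f1
    have g2 : τ₁.var .p = p := by rw [k1 .p (by decide)]; simp
    replace k3 : ∀ i < σ.var .d, τ₁.mem (3 + 2 * p) i = G p i := by simpa [f1] using k3
    refine wp_loop_store (4 + 2 * p) (fun _ => 0) (by decide) (by omega) ?_ ?_
    · intro j hj τ' l1 l2 l3 l4
      have kp : τ'.var .p = p := by rw [l1 .p (by decide), g2]
      refine ⟨?_, by simp [kp], hB.row (by omega) (by omega), by simp; omega, by simp⟩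
      simp [kp]; omega
    intro τ₂ l1 l2 l3 l4
    rw [g1] at l3
    refine ⟨fun s hs => ?_, fun p' hp' j hj => ?_, fun p' hp' j hj => ?_, fun p' hp' => ?_⟩
    · rw [l2 s (by omega), k2 s (by omega)]; exact h1 s hs
    · rw [l2 _ (by omega)]
      by_cases hpp : p' = p
      · subst hpp; exact k3 j hj
      · rw [k2 _ (by omega)]; exact h2 p' (by omega) j hj
    · by_cases hpp : p' = p
      · subst hpp; exact l3 j hj
      · rw [l2 _ (by omega), k2 _ (by omega)]; exact h3 p' (by omega) j hj
    · rw [l2 _ (by omega), k2 _ (by omega)]; exact h4 p' (by omega)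
  · rintro τ hfr ⟨h1, h2, h3, h4⟩
    refine hQ _ (fun z hz => ?_) h1 h2 h3
    rw [St.var_set, if_neg (by rintro rfl; exact hz (by simp [tableCmd, Cmd.writes]))]
    exact hfr z hz

/-- Insert the vector into the next table. -/
def insertCmd : Cmd Var :=
  .loop Var.p Var.d
    (.ite (.load vecRow Var.p)
      (.ite (.load (newRow Var.p) Var.p) .skip
          (.loop Var.j Var.d (.store (newRow Var.p) Var.j (.load vecRow Var.j))) ;;
        .assign Var.b (.load (newRow Var.p) Var.p) ;;
        .assign Var.c (.load vecRow Var.p) ;;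
        .loop Var.j Var.d (.store vecRow Var.j
          ((Var.b *ₑ .load vecRow Var.j +ₑ
            (Var.m -ₑ Var.c) *ₑ .load (newRow Var.p) Var.j) %ₑ Var.m)))
      .skip)

theorem wp_insertCmd {M D N : ℕ} (hB : Bounds M D N) {σ : St Var} {Q : St Var → Prop}
    (hm : 0 < σ.var .m) (hmD : σ.var .m ≤ D + 1) (hd : σ.var .d < N)
    (hT : Echelon (σ.var .m) (σ.var .d) (fun p => σ.mem (4 + 2 * p)))
    (hv : ∀ j < σ.var .d, σ.mem 2 j < σ.var .m)
    (hQ : ∀ τ : St Var, (∀ z, z ∉ insertCmd.writes → τ.var z = σ.var z) →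
      (∀ s, s ≠ 2 → (∀ p, s ≠ 4 + 2 * p) → τ.mem s = σ.mem s) →
      Insertion (σ.var .m) (σ.var .d) (fun p => σ.mem (4 + 2 * p)) (σ.mem 2) (σ.var .d)
        (fun p => τ.mem (4 + 2 * p)) (τ.mem 2) → Q τ) :
    insertCmd.wp M D Q σ := by
  have hlin := hB.lin
  have hND := hB.le_dim
  have hN3 := hB.three_le
  refine Cmd.wp_loop (fun p τ => (∀ s, s ≠ 2 → (∀ p, s ≠ 4 + 2 * p) → τ.mem s = σ.mem s) ∧
      Insertion (σ.var .m) (σ.var .d) (fun p => σ.mem (4 + 2 * p)) (σ.mem 2) p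
        (fun p => τ.mem (4 + 2 * p)) (τ.mem 2))
    (by decide) (by decide) (by decide) (by omega)
    ⟨fun _ _ _ => rfl, Insertion.start hT hv⟩ ?_ ?_
  · rintro p τ hp hfr ⟨h1, h2⟩
    have f1 : τ.var .d = σ.var .d := hfr .d (by decide)
    have f2 : τ.var .m = σ.var .m := hfr .m (by decide)
    -- elimination, once the row `p` is not empty
    have red : ∀ τ' : St Var, (∀ z, z ≠ .j → τ'.var z = (τ.set .p p).var z) →
        (∀ s, s ≠ 2 → (∀ p, s ≠ 4 + 2 * p) → τ'.mem s = σ.mem s) →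
        Insertion (σ.var .m) (σ.var .d) (fun p => σ.mem (4 + 2 * p)) (σ.mem 2) p
          (fun p => τ'.mem (4 + 2 * p)) (τ'.mem 2) → τ'.mem (4 + 2 * p) p ≠ 0 →
        Cmd.wp M D (.assign Var.b (.load (newRow Var.p) Var.p) ;;
          .assign Var.c (.load vecRow Var.p) ;;
          .loop Var.j Var.d (.store vecRow Var.j
            ((Var.b *ₑ .load vecRow Var.j +ₑ
              (Var.m -ₑ Var.c) *ₑ .load (newRow Var.p) Var.j) %ₑ Var.m)))
          (fun τ => (∀ s, s ≠ 2 → (∀ p, s ≠ 4 + 2 * p) → τ.mem s = σ.mem s) ∧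
            Insertion (σ.var .m) (σ.var .d) (fun p => σ.mem (4 + 2 * p)) (σ.mem 2) (p + 1)
              (fun p => τ.mem (4 + 2 * p)) (τ.mem 2)) τ' := by
      intro τ' k1 k2 k3 k4
      have g1 : τ'.var .p = p := by rw [k1 .p (by decide)]; simp
      have g2 : τ'.var .d = σ.var .d := by rw [k1 .d (by decide)]; simpa using f1
      have g3 : τ'.var .m = σ.var .m := by rw [k1 .m (by decide)]; simpa using f2
      have hb := (k3.echelon p hp).1 p hp
      have hc := k3.lt p hp
      refine ⟨?_, ?_, ?_⟩
      · simp only [Ex.Ok, Ex.eval, BinOp.natEval, BinOp.Safe, BinOp.eval, g1]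
        and_intros <;> first | trivial | omega | exact hB.row (by omega) (by omega)
      · simp only [Ex.Ok, Ex.eval, St.var_set, reduceCtorEq, if_false, g1]
        and_intros <;> first | trivial | omega
      refine wp_loop_store (x := Var.j) (y := Var.d) 2
        (fun j => (τ'.mem (4 + 2 * p) p * τ'.mem 2 j +
          (σ.var .m - τ'.mem 2 p) * τ'.mem (4 + 2 * p) j) % σ.var .m) (by decide)
        ?_ ?_ ?_
      · simp [g2]; omega
      · intro j hj τ₁ l1 l2 l3 l4
        replace hj : j < σ.var .d := by simpa [g2] using hj
        have m1 : τ₁.var .p = p := by rw [l1 .p (by decide)]; simpa using g1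
        have m2 : τ₁.var .b = τ'.mem (4 + 2 * p) p := by rw [l1 .b (by decide)]; simp [g1]
        have m3 : τ₁.var .c = τ'.mem 2 p := by rw [l1 .c (by decide)]; simp [g1]
        have m4 : τ₁.var .m = σ.var .m := by rw [l1 .m (by decide)]; simpa using g3
        have m5 : τ₁.mem 2 j = τ'.mem 2 j := l4 j le_rfl
        have m6 : τ₁.mem (4 + 2 * p) = τ'.mem (4 + 2 * p) := l3 _ (by omega)
        have n1 := k3.lt j hj
        have n2 := (k3.echelon p hp).1 j hj
        have p1 : τ'.mem (4 + 2 * p) p * τ'.mem 2 j ≤ (D + 2) * (D + 2) :=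
          Nat.mul_le_mul (by omega) (by omega)
        have p2 : (σ.var .m - τ'.mem 2 p) * τ'.mem (4 + 2 * p) j ≤ (D + 2) * (D + 2) :=
          Nat.mul_le_mul (by omega) (by omega)
        have p3 : 3 * ((D + 2) * (D + 2)) ≤ M := by have := hB.sq_lt; rwa [mul_assoc] at this
        have p4 : 0 < (D + 2) * (D + 2) := by positivity
        simp only [Ex.Ok, Ex.eval, BinOp.natEval, BinOp.Safe, BinOp.eval, l2, m1, m2, m3, m4, m5, m6]
        and_intros <;> first | trivial | omega | exact hB.row (by omega) (by omega)
      · intro τ₁ l1 l2 l3 l4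
        simp only [St.var_set, reduceCtorEq, if_false, g2] at l3
        have hrows : ∀ i, τ₁.mem (4 + 2 * i) = τ'.mem (4 + 2 * i) := fun i => l2 _ (by omega)
        refine ⟨fun s hs hs' => (l2 s hs).trans (k2 s hs hs'), ?_⟩
        simp only [hrows]
        exact k3.reduce hm hp k4 l3
    have hload : (Ex.load vecRow (.var Var.p)).Ok M D (τ.set .p p) := by
      simp; exact ⟨by omega, by omega, hB.row (by omega) (by omega)⟩
    have hload' : (Ex.load (newRow Var.p) (.var Var.p)).Ok M D (τ.set .p p) := by
      simp; exact ⟨by omega, by omega, hB.row (by omega) (by omega)⟩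
    refine ⟨hload, fun hne => ?_, fun h0 => ?_⟩
    · replace hne : τ.mem 2 p ≠ 0 := by simpa using hne
      refine ⟨hload', fun hne' => ?_, fun h0 => ?_⟩
      · exact red _ (fun _ _ => rfl) h1 h2 (by simpa using hne')
      · replace h0 : τ.mem (4 + 2 * p) p = 0 := by simpa using h0
        refine wp_loop_store (4 + 2 * p) (τ.mem 2) (by decide) (by simp [f1]; omega) ?_ ?_
        · intro j hj τ' k1 k2 k3 k4
          have kp : τ'.var .p = p := by rw [k1 .p (by decide)]; simp
          replace hj : j < σ.var .d := by simpa [f1] using hj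
          have k5 : τ'.mem 2 = τ.mem 2 := k3 _ (by omega)
          simp only [Ex.Ok, Ex.eval, BinOp.natEval, BinOp.Safe, BinOp.eval, k2, kp, k5]
          and_intros <;> first | trivial | omega | exact hB.row (by omega) (by omega)
        · intro τ' k1 k2 k3 k4
          replace k3 : ∀ j < σ.var .d, τ'.mem (4 + 2 * p) j = τ.mem 2 j := by simpa [f1] using k3
          have k5 : τ'.mem 2 = τ.mem 2 := k2 _ (by omega)
          refine red τ' k1 (fun s hs hs' => (k2 s (hs' p)).trans (h1 s hs hs')) ?_ ?_
          · rw [k5]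
            refine h2.fill hp hne h0 (fun i hi hip j hj => ?_) k3
            rw [k2 _ (by omega)]; rfl
          · rw [k3 p hp]; exact hne
    · exact ⟨h1, h2.next_of_eq_zero (by simpa using h0)⟩
  · rintro τ hfr ⟨h1, h2⟩
    refine hQ _ (fun z hz => ?_) h1 h2
    rw [St.var_set, if_neg (by rintro rfl; exact hz (by decide))]
    exact hfr z hz

theorem Cmd.wp_of_eq {V : Type} [DecidableEq V] {M D : ℕ} {s : Cmd V} {Q : St V → Prop} {σ : St V}
    (h : ∀ τ, τ = σ → s.wp M D Q τ) : s.wp M D Q σ := h σ rfl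

theorem Cmd.wp_of_frame {V : Type} [DecidableEq V] {M D : ℕ} {s : Cmd V} {Q Q' : St V → Prop}
    {σ : St V} (h : s.wp M D Q σ)
    (hQ : ∀ τ, (∀ z, z ∉ s.writes → τ.var z = σ.var z) → Q τ → Q' τ) : s.wp M D Q' σ :=
  wp_mono (fun τ hτ => hQ τ hτ.2 hτ.1) (wp_frame h)

/-- The variables and the input describe the words `u` (a factor of the first word of the input)
and `x`, and the number `k`. -/
structure Setup (N : ℕ) (inp : ℕ → ℕ) (u x : List ℕ) (k : ℕ) (σ : St Var) : Prop where
  mem_eq : σ.mem 0 = inp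
  l_eq : σ.var .l = u.length
  lx_eq : σ.var .lx = x.length
  d_eq : σ.var .d = u.length + x.length + 2
  N_eq : σ.var .N = N
  k_eq : σ.var .k = k
  k_le : k ≤ N
  i_le : σ.var .i + u.length ≤ σ.var .n
  n_le : σ.var .n + x.length + 3 ≤ N
  u_at : ∀ c (h : c < u.length), inp (1 + σ.var .i + c) = u[c]
  x_at : ∀ c (h : c < x.length), inp (σ.var .n + 2 + c) = x[c]

theorem Setup.congr {N k : ℕ} {inp : ℕ → ℕ} {u x : List ℕ} {σ τ : St Var}
    (h : Setup N inp u x k σ)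
    (hv : ∀ z ∈ [Var.l, .lx, .d, .N, .k, .i, .n], τ.var z = σ.var z) (hm : τ.mem 0 = σ.mem 0) :
    Setup N inp u x k τ := by
  simp only [List.mem_cons, List.not_mem_nil, or_false, forall_eq_or_imp, forall_eq] at hv
  obtain ⟨h1, h2, h3, h4, h5, h6, h7⟩ := hv
  exact ⟨hm.trans h.mem_eq, h1.trans h.l_eq, h2.trans h.lx_eq, h3.trans h.d_eq, h4.trans h.N_eq, h5.trans h.k_eq,
    h.k_le, by rw [h6, h7]; exact h.i_le, by rw [h7]; exact h.n_le, by rw [h6]; exact h.u_at,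
    by rw [h7]; exact h.x_at⟩

theorem Setup.exists_inp {N k : ℕ} {inp : ℕ → ℕ} {u x : List ℕ} {σ : St Var}
    (h : Setup N inp u x k σ) (a : ℕ) (ha : a ∈ u ∨ a ∈ x) : ∃ q < N, inp q = a := by
  have h1 := h.i_le
  have h2 := h.n_le
  rcases ha with ha | ha
  · obtain ⟨c, hc, rfl⟩ := List.getElem_of_mem ha
    exact ⟨_, by omega, h.u_at c hc⟩
  · obtain ⟨c, hc, rfl⟩ := List.getElem_of_mem ha
    exact ⟨_, by omega, h.x_at c hc⟩

/-- Extend row `r` of the current table by the letter in cell `q` of the input, compare the entries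
of the resulting vector for the two words, and insert it into the next table. -/
def stepCmd : Cmd Var :=
  .assign .a (.load (.lit 0) Var.q) ;;
  .assign .base (.lit 1 +ₑ Var.i) ;;
  .assign .off (.lit 0) ;;
  .assign .len Var.l ;;
  extendCmd ;;
  .assign .base (Var.n +ₑ .lit 2) ;;
  .assign .off (Var.l +ₑ .lit 1) ;;
  .assign .len Var.lx ;;
  extendCmd ;;
  .ite (.load vecRow Var.l =ₑ .load vecRow (Var.d -ₑ .lit 1)) .skip (.assign .bad (.lit 1)) ;;
  insertCmd

theorem wp_stepCmd {M D N : ℕ} (hB : Bounds M D N) {inp : ℕ → ℕ} {u x : List ℕ} {k j : ℕ}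
    {σ : St Var} {Q : St Var → Prop} {H : Prop} {done : ℕ → ℕ → Prop}
    (hS : Setup N inp u x k σ) (hm : 0 < σ.var .m) (hmD : σ.var .m ≤ D + 1) (hj : j < k)
    (hr : σ.var .r < σ.var .d) (hq : σ.var .q < N)
    (hold : SpansLayer u x (σ.var .m) (σ.var .d) j (fun p => σ.mem (3 + 2 * p)))
    (hst : RoundState u x (σ.var .m) (σ.var .d) k j inp (fun p => σ.mem (3 + 2 * p))
      (fun p => σ.mem (4 + 2 * p)) (σ.var .bad) H done)
    (hQ : ∀ τ : St Var, (∀ z, z ∉ stepCmd.writes → τ.var z = σ.var z) →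
      (∀ s, s ≠ 2 → (∀ p, s ≠ 4 + 2 * p) → τ.mem s = σ.mem s) →
      RoundState u x (σ.var .m) (σ.var .d) k j inp (fun p => σ.mem (3 + 2 * p))
        (fun p => τ.mem (4 + 2 * p)) (τ.var .bad) H
        (fun r' q' => done r' q' ∨ (r' = σ.var .r ∧ q' = σ.var .q)) → Q τ) :
    stepCmd.wp M D Q σ := by
  have hlin := hB.lin
  have hND := hB.le_dim
  have hN3 := hB.three_le
  have s1 := hS.l_eq
  have s2 := hS.lx_eq
  have s3 := hS.d_eq
  have s4 := hS.i_le
  have s5 := hS.n_le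
  have hrow := (hold.echelon (σ.var .r) hr).1
  refine Cmd.wp_of_frame (Q := fun τ =>
    (∀ s, s ≠ 2 → (∀ p, s ≠ 4 + 2 * p) → τ.mem s = σ.mem s) ∧
      RoundState u x (σ.var .m) (σ.var .d) k j inp (fun p => σ.mem (3 + 2 * p))
        (fun p => τ.mem (4 + 2 * p)) (τ.var .bad) H
        (fun r' q' => done r' q' ∨ (r' = σ.var .r ∧ q' = σ.var .q))) ?_
    fun τ hf h => hQ τ hf h.1 h.2
  refine ⟨?_, ?_, ?_, trivial, ?_⟩
  · simp only [Ex.Ok, Ex.eval]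
    and_intros <;> first | trivial | omega
  · simp only [Ex.Ok, Ex.eval, BinOp.Safe, St.var_set, reduceCtorEq, if_false]
    and_intros <;> first | trivial | omega
  · simp only [Ex.Ok]; omega
  refine Cmd.wp_of_eq fun σ₁ hσ₁ => ?_
  have a1 : σ₁.var .base = 1 + σ.var .i := by rw [hσ₁]; simp
  have a2 : σ₁.var .off = 0 := by rw [hσ₁]; simp
  have a3 : σ₁.var .len = u.length := by rw [hσ₁]; simp [s1]
  have a4 : σ₁.var .a = inp (σ.var .q) := by rw [hσ₁]; simp [hS.mem_eq]
  have a5 : ∀ z, z ≠ .base → z ≠ .off → z ≠ .len → z ≠ .a → σ₁.var z = σ.var z := by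
    intro z h1 h2 h3 h4; rw [hσ₁]; simp [h1, h2, h3, h4]
  have a6 : σ₁.mem = σ.mem := by rw [hσ₁]; rfl
  have a7 : σ₁.var .m = σ.var .m := a5 _ (by decide) (by decide) (by decide) (by decide)
  have a8 : σ₁.var .r = σ.var .r := a5 _ (by decide) (by decide) (by decide) (by decide)
  clear hσ₁
  refine wp_extendCmd hB (by omega) (by omega) (by omega) (by omega) (by omega) ?_ ?_
  · intro c hc
    rw [a6, a7, a8, a2]
    exact hrow _ (by omega)
  intro σ₂ b1 b2 b3 b4 b5
  rw [a6] at b2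
  simp only [a1, a2, a3, a4, a6, a7, a8, hS.mem_eq, zero_add] at b3 b4
  have c1 : ∀ z, z ≠ .base → z ≠ .off → z ≠ .len → z ≠ .a → z ≠ .c → σ₂.var z = σ.var z := by
    intro z h1 h2 h3 h4 h5
    rw [b1 z (by simpa [extendCmd, Cmd.writes] using h5), a5 z h1 h2 h3 h4]
  have c2 : σ₂.var .a = inp (σ.var .q) := by rw [b1 .a (by decide), a4]
  have c3 : σ₂.var .n = σ.var .n :=
    c1 _ (by decide) (by decide) (by decide) (by decide) (by decide)
  have c4 : σ₂.var .l = σ.var .l :=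
    c1 _ (by decide) (by decide) (by decide) (by decide) (by decide)
  have c5 : σ₂.var .lx = σ.var .lx :=
    c1 _ (by decide) (by decide) (by decide) (by decide) (by decide)
  clear b1 a1 a2 a3 a4 a5 a6 a7 a8
  refine ⟨?_, ?_, trivial, ?_⟩
  · simp only [Ex.Ok, Ex.eval, BinOp.Safe]
    and_intros <;> first | trivial | omega
  · simp only [Ex.Ok, Ex.eval, BinOp.Safe, St.var_set, reduceCtorEq, if_false]
    and_intros <;> first | trivial | omega
  refine Cmd.wp_of_eq fun σ₃ hσ₃ => ?_
  have a1 : σ₃.var .base = σ.var .n + 2 := by rw [hσ₃]; simp [c3]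
  have a2 : σ₃.var .off = u.length + 1 := by rw [hσ₃]; simp [c4, s1]
  have a3 : σ₃.var .len = x.length := by rw [hσ₃]; simp [c5, s2]
  have a4 : σ₃.var .a = inp (σ.var .q) := by rw [hσ₃]; simp [c2]
  have a5 : ∀ z, z ≠ .base → z ≠ .off → z ≠ .len → z ≠ .a → z ≠ .c → σ₃.var z = σ.var z := by
    intro z h1 h2 h3 h4 h5; rw [hσ₃]; simp [h1, h2, h3, c1 z h1 h2 h3 h4 h5]
  have a6 : σ₃.mem = σ₂.mem := by rw [hσ₃]; rfl
  have a7 : σ₃.var .m = σ.var .m :=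
    a5 _ (by decide) (by decide) (by decide) (by decide) (by decide)
  have a8 : σ₃.var .r = σ.var .r :=
    a5 _ (by decide) (by decide) (by decide) (by decide) (by decide)
  have a9 : σ₃.mem (3 + 2 * σ.var .r) = σ.mem (3 + 2 * σ.var .r) := by
    rw [a6, b2 _ (by omega)]
  have a10 : σ₃.mem 0 = inp := by rw [a6, b2 _ (by omega), hS.mem_eq]
  clear hσ₃
  refine wp_extendCmd hB (by omega) (by omega) (by omega) (by omega) (by omega) ?_ ?_
  · intro c hc
    rw [a7, a8, a9, a2]
    exact hrow _ (by omega)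
  intro σ₄ d1 d2 d3 d4 d5
  simp only [a1, a2, a3, a4, a7, a8, a9, a10] at d3 d4 d5
  have e1 : ∀ z, z ≠ .base → z ≠ .off → z ≠ .len → z ≠ .a → z ≠ .c → σ₄.var z = σ.var z := by
    intro z h1 h2 h3 h4 h5
    rw [d1 z (by simpa [extendCmd, Cmd.writes] using h5), a5 z h1 h2 h3 h4 h5]
  have e2 : ∀ s, s ≠ 2 → σ₄.mem s = σ.mem s := fun s hs => by
    rw [d2 s hs, a6, b2 s hs]
  have e3 : ∀ c ≤ u.length, σ₄.mem 2 c = σ₂.mem 2 c := fun c hc => by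
    rw [d5 c (by omega), a6]
  clear d1 d2 d5 a1 a2 a3 a4 a5 a6 a7 a8 a9 a10 c1 c2 c3 c4 c5
  -- the vector that has been computed
  have hv0 : σ₄.mem 2 0 = 0 := by rw [e3 0 (by omega), b3]
  have hvs : ∀ c, c + 1 < σ.var .d → σ₄.mem 2 (c + 1) = match letterAt u x c with
      | none => 0
      | some b => (σ₄.mem 2 c + (if b = inp (σ.var .q) then 1 else 0) *
          σ.mem (3 + 2 * σ.var .r) c) % σ.var .m := by
    intro c hc
    rcases lt_trichotomy c u.length with h | h | h
    · rw [letterAt, if_pos h, List.getElem?_eq_getElem h, e3 _ (by omega), e3 _ (by omega), b4 c h,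
        hS.u_at c h]
    · rw [letterAt, if_neg (by omega), if_pos h, h]
      exact d3
    · obtain ⟨e, rfl⟩ : ∃ e, c = u.length + 1 + e := ⟨c - u.length - 1, by omega⟩
      have he : e < x.length := by omega
      have h1 : u.length + 1 + e - u.length - 1 = e := by omega
      rw [letterAt, if_neg (by omega), if_neg (by omega), h1, List.getElem?_eq_getElem he, d4 e he,
        hS.x_at e he]
  have hvlt : ∀ c < σ.var .d, σ₄.mem 2 c < σ.var .m := by
    intro c hc
    cases c with
    | zero => rw [hv0]; exact hm
    | succ c =>
      rw [hvs c hc]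
      cases letterAt u x c with
      | none => exact hm
      | some b => exact Nat.mod_lt _ hm
  have hvec := modVec_eq_extend (m := σ.var .m) s3 hv0 hvs
  have g1 : σ₄.var .l = u.length := by
    rw [e1 _ (by decide) (by decide) (by decide) (by decide) (by decide), s1]
  have g2 : σ₄.var .d = σ.var .d :=
    e1 _ (by decide) (by decide) (by decide) (by decide) (by decide)
  have g3 : σ₄.var .bad = σ.var .bad :=
    e1 _ (by decide) (by decide) (by decide) (by decide) (by decide)
  have g4 : σ₄.var .m = σ.var .m :=
    e1 _ (by decide) (by decide) (by decide) (by decide) (by decide)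
  have hins : ∀ τ : St Var, τ.mem = σ₄.mem → τ.var .d = σ.var .d → τ.var .m = σ.var .m →
      τ.var .bad = (if σ₄.mem 2 u.length = σ₄.mem 2 (σ.var .d - 1) then σ.var .bad else 1) →
      insertCmd.wp M D (fun τ => (∀ s, s ≠ 2 → (∀ p, s ≠ 4 + 2 * p) → τ.mem s = σ.mem s) ∧
        RoundState u x (σ.var .m) (σ.var .d) k j inp (fun p => σ.mem (3 + 2 * p))
          (fun p => τ.mem (4 + 2 * p)) (τ.var .bad) H
          (fun r' q' => done r' q' ∨ (r' = σ.var .r ∧ q' = σ.var .q))) τ := by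
    intro τ k1 k2 k3 k4
    have k5 : ∀ p, τ.mem (4 + 2 * p) = σ.mem (4 + 2 * p) := fun p => by
      rw [k1, e2 _ (by omega)]
    refine wp_insertCmd hB (by omega) (by omega) (by omega) ?_ ?_ ?_
    · simp only [k2, k3, k5]; exact hst.echelon
    · rw [k1, k2, k3]; exact hvlt
    intro τ' l1 l2 l3
    simp only [k2, k3, k5, k1] at l3
    refine ⟨fun s hs hs' => by rw [l2 s hs hs', k1, e2 s hs], ?_⟩
    refine hst.insert s3 hold.rows hr hj hvlt hvec l3 ?_
    rw [l1 .bad (by decide), k4]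
  refine ⟨?_, fun hne => ?_, fun h0 => ?_⟩
  · simp only [Ex.Ok, Ex.eval, BinOp.natEval, BinOp.Safe, g1, g2]
    and_intros <;> first | trivial | omega
  · refine hins σ₄ rfl g2 g4 ?_
    simp [g1, g2] at hne
    rw [if_pos hne, g3]
  · refine ⟨by simp only [Ex.Ok]; omega, hins _ rfl (by simpa using g2) (by simpa using g4) ?_⟩
    simp [g1, g2] at h0
    simp [h0]

/-- Compute the next table, and make it the current one. -/
def roundCmd : Cmd Var :=
  .loop .r .d (.loop .q .N stepCmd) ;; tableCmd (.load (newRow Var.p) Var.j)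

/-- What is known after the words of length at most `j` have been dealt with modulo `m`. -/
structure LayerState (u x : List ℕ) (m d k j : ℕ) (H : Prop) (τ : St Var) : Prop where
  spans : SpansLayer u x m d j (fun p => τ.mem (3 + 2 * p))
  new_eq_zero : ∀ p < d, ∀ c < d, τ.mem (4 + 2 * p) c = 0
  sound : τ.var .bad ≠ 0 → ¬ BinomEquiv k u x
  hist : τ.var .bad = 0 → H
  gap_eq_zero : τ.var .bad = 0 → m.Prime → ∀ y : List ℕ, y.length ≤ j →
    gap u x (ZMod m) (countVec u x (ZMod m) y) = 0

theorem wp_roundCmd {M D N : ℕ} (hB : Bounds M D N) {inp : ℕ → ℕ} {u x : List ℕ} {k j : ℕ}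
    {σ : St Var} {Q : St Var → Prop} {H : Prop}
    (hS : Setup N inp u x k σ) (hm : 0 < σ.var .m) (hmD : σ.var .m ≤ D + 1) (hj : j < k)
    (hL : LayerState u x (σ.var .m) (σ.var .d) k j H σ)
    (hQ : ∀ τ : St Var, (∀ z, z ∉ roundCmd.writes → τ.var z = σ.var z) →
      (∀ s, s < 2 → τ.mem s = σ.mem s) →
      LayerState u x (σ.var .m) (σ.var .d) k (j + 1) H τ → Q τ) :
    roundCmd.wp M D Q σ := by
  have hlin := hB.lin
  have hND := hB.le_dim
  have hN3 := hB.three_le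
  have s3 := hS.d_eq
  have s4 := hS.i_le
  have s5 := hS.n_le
  have s6 := hS.N_eq
  refine Cmd.wp_of_frame (Q := fun τ => (∀ s, s < 2 → τ.mem s = σ.mem s) ∧
      LayerState u x (σ.var .m) (σ.var .d) k (j + 1) H τ) ?_ fun τ hf h => hQ τ hf h.1 h.2
  set H' : Prop := H ∧ ((σ.var .m).Prime → ∀ y : List ℕ, y.length ≤ j →
    gap u x (ZMod (σ.var .m)) (countVec u x (ZMod (σ.var .m)) y) = 0) with hH'
  let I : (ℕ → ℕ → Prop) → St Var → Prop := fun done τ =>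
    (∀ s, s ≠ 2 → (∀ p, s ≠ 4 + 2 * p) → τ.mem s = σ.mem s) ∧
      RoundState u x (σ.var .m) (σ.var .d) k j inp (fun p => σ.mem (3 + 2 * p))
        (fun p => τ.mem (4 + 2 * p)) (τ.var .bad) H' done
  refine Cmd.wp_loop (fun r => I (fun r' q' => r' < r ∧ q' < N)) (by decide) (by decide)
    (by decide) (by omega) ⟨fun _ _ _ => rfl, RoundState.start hm hL.new_eq_zero hL.sound
      (fun hb => ⟨hL.hist hb, hL.gap_eq_zero hb⟩) (by simp)⟩ ?_ ?_
  · intro r τ hr hfr hI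
    have f1 : ∀ z, z ∉ (Cmd.loop .r .d (Cmd.loop .q .N stepCmd)).writes →
      τ.var z = σ.var z := hfr
    have f2 : τ.var .N = N := by rw [f1 .N (by decide), s6]
    refine Cmd.wp_loop (fun q τ' => I (fun r' q' => (r' < r ∧ q' < N) ∨ (r' = r ∧ q' < q)) τ')
      (by decide) (by decide) (by decide) (by simp [f2]; omega) ⟨hI.1, hI.2.mono (by simp)⟩ ?_ ?_
    · intro q τ₁ hq hfr₁ hI₁
      replace hq : q < N := by simpa [f2] using hq
      have f3 : ∀ z, z ∉ (Cmd.loop .r .d (Cmd.loop .q .N stepCmd)).writes →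
          τ₁.var z = σ.var z := fun z hz => by
        have hz' : z ∉ (Cmd.loop .q .N stepCmd).writes ∧ z ≠ .r := by
          simp only [Cmd.writes, List.mem_cons, not_or] at hz ⊢
          exact ⟨hz.2, hz.1⟩
        rw [hfr₁ z hz'.1, St.var_set, if_neg hz'.2, f1 z hz]
      have f4 : τ₁.var .r = r := by rw [hfr₁ .r (by decide)]; simp
      have f5 : τ₁.var .d = σ.var .d := f3 .d (by decide)
      have f6 : τ₁.var .m = σ.var .m := f3 .m (by decide)
      have hrows : ∀ p, τ₁.mem (3 + 2 * p) = σ.mem (3 + 2 * p) := fun p =>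
        hI₁.1 _ (by omega) (by omega)
      refine wp_stepCmd hB (inp := inp) (u := u) (x := x) (k := k) (j := j) (H := H')
        (done := fun r' q' => (r' < r ∧ q' < N) ∨ (r' = r ∧ q' < q)) (hS.congr ?_ ?_)
        (by simpa [f6] using hm) (by simpa [f6] using hmD) hj (by simpa [f4, f5] using hr)
        (by simpa using hq) ?_ ?_ ?_
      · intro z hz
        rw [St.var_set, if_neg (by rintro rfl; revert hz; decide)]
        exact f3 z (by revert z; decide)
      · exact hI₁.1 0 (by omega) (by omega)
      · simpa [f5, f6, hrows] using hL.spans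
      · simpa [f5, f6, hrows] using hI₁.2
      · intro τ₂ g1 g2 g3
        refine ⟨fun s hs hs' => (g2 s hs hs').trans (hI₁.1 s hs hs'), ?_⟩
        simp only [St.var_set, reduceCtorEq, if_false, if_true, St.mem_set, f4, f5, f6, hrows] at g3
        exact g3.mono fun r' q' h => by omega
    · intro τ₁ hfr₁ hI₁
      simp only [St.var_set, reduceCtorEq, if_false, f2] at hI₁
      exact ⟨hI₁.1, hI₁.2.mono fun r' q' h => by omega⟩
  · intro τ hfr hI
    have f5 : τ.var .d = σ.var .d := hfr .d (by decide)
    obtain ⟨h1, h2⟩ := hI.2.finish hL.spans hS.exists_inp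
    refine wp_tableCmd hB (fun p c => τ.mem (4 + 2 * p) c) (by simp [f5]; omega) ?_ ?_
    · intro p hp c hc τ₁ g1 g2 g3
      replace hp : p < σ.var .d := by simpa [f5] using hp
      replace hc : c < σ.var .d := by simpa [f5] using hc
      simp only [Ex.Ok, Ex.eval, BinOp.natEval, BinOp.Safe, BinOp.eval, g1, g2, g3 p le_rfl]
      and_intros <;> first | trivial | omega | exact hB.row (by omega) (by omega)
    · intro τ₁ g1 g2 g3 g4
      have hb : τ₁.var .bad = τ.var .bad := by rw [g1 .bad (by decide)]; simp
      simp only [St.var_set, reduceCtorEq, if_false, f5] at g3 g4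
      refine ⟨fun s hs => (g2 s (by omega)).trans (hI.1 s (by omega) (by omega)),
        h1.congr g3, g4, fun h => hI.2.sound (hb ▸ h), fun h => (hI.2.hist (hb ▸ h)).1,
        fun h hp y hy => ?_⟩
      rcases Nat.lt_or_ge j y.length with hlt | hge
      · exact h2 hp (hb ▸ h) y (by omega)
      · exact (hI.2.hist (hb ▸ h)).2 hp y hge

/-- Compare the two words modulo `m`. -/
def modCmd : Cmd Var :=
  tableCmd (Var.p =ₑ .lit 0) ;; .loop .rnd .k roundCmd

theorem wp_modCmd {M D N : ℕ} (hB : Bounds M D N) {inp : ℕ → ℕ} {u x : List ℕ} {k : ℕ}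
    {σ : St Var} {Q : St Var → Prop} {H : Prop}
    (hS : Setup N inp u x k σ) (hm : 2 ≤ σ.var .m) (hmD : σ.var .m ≤ D + 1)
    (hb : σ.var .bad ≠ 0 → ¬ BinomEquiv k u x) (hH : σ.var .bad = 0 → H)
    (hQ : ∀ τ : St Var, (∀ z, z ∉ modCmd.writes → τ.var z = σ.var z) →
      (∀ s, s < 2 → τ.mem s = σ.mem s) → (τ.var .bad ≠ 0 → ¬ BinomEquiv k u x) →
      (τ.var .bad = 0 → H ∧ ((σ.var .m).Prime → ∀ y : List ℕ, y.length ≤ k →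
        wordBinom u y ≡ wordBinom x y [MOD σ.var .m])) → Q τ) :
    modCmd.wp M D Q σ := by
  have hlin := hB.lin
  have hND := hB.le_dim
  have hN3 := hB.three_le
  have s3 := hS.d_eq
  have s4 := hS.i_le
  have s5 := hS.n_le
  have s6 := hS.k_eq
  have s7 := hS.k_le
  refine Cmd.wp_of_frame (Q := fun τ => (∀ s, s < 2 → τ.mem s = σ.mem s) ∧
      LayerState u x (σ.var .m) (σ.var .d) k k H τ) ?_ fun τ hf h => hQ τ hf h.1 h.2.sound
        fun hb => ⟨h.2.hist hb, fun hp y hy => ?_⟩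
  · refine wp_tableCmd hB (fun p _ => if p = 0 then 1 else 0) (by omega) ?_ ?_
    · intro p hp c hc τ g1 g2 _
      simp only [Ex.Ok, Ex.eval, BinOp.natEval, BinOp.Safe, BinOp.eval, g1]
      and_intros <;> first | trivial | omega
    intro τ g1 g2 g3 g4
    have gk : τ.var .k = k := by rw [g1 .k (by decide), s6]
    have gb : τ.var .bad = σ.var .bad := g1 .bad (by decide)
    refine Cmd.wp_loop (fun j τ' => (∀ s, s < 2 → τ'.mem s = σ.mem s) ∧
      LayerState u x (σ.var .m) (σ.var .d) k j H τ') (by decide) (by decide) (by decide)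
      (by omega) ⟨fun s hs => g2 s (by omega), spansLayer_zero s3 hm g3, g4, by rwa [gb],
        by rwa [gb], fun _ _ y hy => ?_⟩ ?_ ?_
    · rw [List.length_eq_zero_iff.1 (Nat.le_zero.1 hy), gap_countVec, wordBinom_nil_right,
        wordBinom_nil_right, sub_self]
    · intro j τ₁ hj hfr ⟨h1, h2⟩
      rw [gk] at hj
      have f1 : ∀ z, z ∉ modCmd.writes → (τ₁.set .rnd j).var z = σ.var z := fun z hz => by
        have hz' : z ∉ (Cmd.loop .rnd .k roundCmd).writes ∧
            z ∉ (tableCmd (Var.p =ₑ .lit 0)).writes := by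
          simp only [modCmd, Cmd.writes, List.mem_append, not_or] at hz ⊢
          exact ⟨hz.2, hz.1⟩
        rw [St.var_set, if_neg, hfr z hz'.1, g1 z hz'.2]
        rintro rfl
        exact hz (by decide)
      have f2 := f1 .m (by decide)
      have f3 := f1 .d (by decide)
      refine wp_roundCmd hB (inp := inp) (u := u) (x := x) (k := k) (j := j) (H := H)
        (hS.congr (fun z hz => f1 z (by revert z; decide)) (h1 0 (by omega))) (by omega) (by omega)
        hj ?_ ?_
      · rw [f2, f3]
        exact ⟨h2.spans, h2.new_eq_zero, h2.sound, h2.hist, h2.gap_eq_zero⟩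
      · intro τ₂ k1 k2 k3
        rw [f2, f3] at k3
        exact ⟨fun s hs => (k2 s hs).trans (h1 s hs), k3⟩
    · intro τ₁ hfr ⟨h1, h2⟩
      rw [gk] at h2
      exact ⟨h1, h2.spans, h2.new_eq_zero, h2.sound, h2.hist, h2.gap_eq_zero⟩
  · have := h.2.gap_eq_zero hb hp y hy
    rw [gap_countVec, sub_eq_zero] at this
    exact (ZMod.natCast_eq_natCast_iff _ _ _).1 this

/-- Decide whether the two words are equivalent. -/
def testCmd : Cmd Var :=
  .assign .bad (.lit 0) ;;
  .assign .d (Var.l +ₑ Var.lx +ₑ .lit 2) ;;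
  .assign .lim .dim ;;
  .loop .m₀ .lim (.assign .m (Var.m₀ +ₑ .lit 2) ;; modCmd)

theorem wp_testCmd {M N : ℕ} (hB : Bounds M (N ^ 4) N) {inp : ℕ → ℕ} {u x : List ℕ} {k : ℕ}
    {σ : St Var} {Q : St Var → Prop}
    (hS : Setup N inp u x k (σ.set .d (u.length + x.length + 2)))
    (hQ : ∀ τ : St Var, (∀ z, z ∉ testCmd.writes → τ.var z = σ.var z) →
      (∀ s, s < 2 → τ.mem s = σ.mem s) → (τ.var .bad = 0 ↔ BinomEquiv k u x) → Q τ) :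
    testCmd.wp M (N ^ 4) Q σ := by
  have hlin := hB.lin
  have hND := hB.le_dim
  have hN3 := hB.three_le
  have s1 : σ.var .l = u.length := by simpa using hS.l_eq
  have s2 : σ.var .lx = x.length := by simpa using hS.lx_eq
  have s4 : σ.var .i + u.length ≤ σ.var .n := by simpa using hS.i_le
  have s5 : σ.var .n + x.length + 3 ≤ N := by simpa using hS.n_le
  refine Cmd.wp_of_frame (Q := fun τ => (∀ s, s < 2 → τ.mem s = σ.mem s) ∧
      (τ.var .bad = 0 ↔ BinomEquiv k u x)) ?_ fun τ hf h => hQ τ hf h.1 h.2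
  refine ⟨by simp only [Ex.Ok]; omega, ?_, trivial, ?_⟩
  · simp only [Ex.Ok, Ex.eval, BinOp.natEval, BinOp.Safe, BinOp.eval, St.var_set, reduceCtorEq,
      if_false, s1, s2]
    and_intros <;> first | trivial | omega
  refine Cmd.wp_of_eq fun σ₁ hσ₁ => ?_
  have a1 : σ₁.var .lim = N ^ 4 := by rw [hσ₁]; simp
  have a2 : σ₁.var .bad = 0 := by rw [hσ₁]; simp
  have a3 : σ₁.mem = σ.mem := by rw [hσ₁]; rfl
  have a4 : Setup N inp u x k σ₁ := by
    refine hS.congr (fun z hz => ?_) (by rw [hσ₁]; rfl)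
    rw [hσ₁]
    fin_cases hz <;> simp [s1, s2]
  refine Cmd.wp_loop (fun j τ => (∀ s, s < 2 → τ.mem s = σ.mem s) ∧
      (τ.var .bad ≠ 0 → ¬ BinomEquiv k u x) ∧
      (τ.var .bad = 0 → ∀ p : ℕ, p.Prime → p < j + 2 → ∀ y : List ℕ, y.length ≤ k →
        wordBinom u y ≡ wordBinom x y [MOD p]))
    (by decide) (by decide) (by decide) (by omega)
    ⟨fun s _ => by rw [a3], fun h => absurd a2 h, fun _ p hp hlt => absurd hp.two_le (by omega)⟩
    ?_ ?_
  · rintro j τ hj hfr ⟨h1, h2, h3⟩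
    rw [a1] at hj
    refine ⟨by simp; omega, ?_⟩
    refine Cmd.wp_of_eq fun τ₁ hτ₁ => ?_
    have b1 : τ₁.var .m = j + 2 := by rw [hτ₁]; simp
    have b2 : τ₁.var .bad = τ.var .bad := by rw [hτ₁]; simp
    have b3 : τ₁.mem = τ.mem := by rw [hτ₁]; rfl
    refine wp_modCmd hB (inp := inp) (u := u) (x := x) (k := k)
      (H := ∀ p : ℕ, p.Prime → p < j + 2 → ∀ y : List ℕ, y.length ≤ k →
        wordBinom u y ≡ wordBinom x y [MOD p])
      (a4.congr (fun z hz => ?_) (by rw [b3, a3, h1 0 (by omega)])) (by omega) (by omega)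
      (by rwa [b2]) (by rwa [b2]) ?_
    · rw [← hfr z (by revert z; decide), hτ₁]
      fin_cases hz <;> simp
    · intro τ₂ k1 k2 k3 k4
      refine ⟨fun s hs => by rw [k2 s hs, b3, h1 s hs], k3, fun hb p hp hlt => ?_⟩
      rcases Nat.lt_or_ge p (j + 2) with h | h
      · exact (k4 hb).1 p hp h
      · obtain rfl : p = j + 2 := by omega
        rw [b1] at k4
        exact (k4 hb).2 hp
  · rintro τ hfr ⟨h1, h2, h3⟩
    rw [a1] at h3
    refine ⟨h1, ?_⟩
    simp only [St.var_set, reduceCtorEq, if_false]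
    refine ⟨fun hb y hy => ?_, fun he => by_contra fun hb => h2 hb he⟩
    by_contra hne
    have hu : wordBinom u y ≤ 2 ^ N :=
      (wordBinom_le u y).trans (Nat.pow_le_pow_right (by norm_num) (by omega))
    have hx : wordBinom x y ≤ 2 ^ N :=
      (wordBinom_le x y).trans (Nat.pow_le_pow_right (by norm_num) (by omega))
    obtain ⟨p, hp, hpN, hnot⟩ := exists_prime_not_modEq hN3 hu hx hne
    exact hnot (h3 hb p hp (by omega) y hy)

/-- Read the input, and write down all matches. -/
def matchCmd : Cmd Var :=
  .assign .n (.load (.lit 0) (.lit 0)) ;;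
  .assign .lx (.load (.lit 0) (Var.n +ₑ .lit 1)) ;;
  .assign .kb (.load (.lit 0) (Var.n +ₑ Var.lx +ₑ .lit 2)) ;;
  .assign .N (Var.n +ₑ Var.lx +ₑ Var.kb +ₑ .lit 3) ;;
  .assign .k (.lit 0) ;;
  .loop .j .kb
    (.assign .k (.lit 2 *ₑ Var.k +ₑ .load (.lit 0) (Var.N -ₑ .lit 1 -ₑ Var.j)) ;;
      .ite (Var.N <ₑ Var.k) (.assign .k Var.N) .skip) ;;
  .assign .out (.lit 0) ;;
  .assign .nn ((Var.n +ₑ .lit 1) *ₑ (Var.n +ₑ .lit 1)) ;;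
  .loop .t .nn
    (.assign .i (Var.t /ₑ (Var.n +ₑ .lit 1)) ;;
      .assign .l (Var.t %ₑ (Var.n +ₑ .lit 1)) ;;
      .ite (Var.i +ₑ Var.l <ₑ Var.n +ₑ .lit 1)
        (testCmd ;;
          .ite Var.bad .skip
            (.store (.lit 1) Var.out Var.i ;;
              .store (.lit 1) (Var.out +ₑ .lit 1) Var.l ;;
              .assign .out (Var.out +ₑ .lit 2)))
        .skip)

/-- The sequence `inp` starts with the words `w` and `x` and with the list `ds`, each preceded by
its length. -/
structure IsInput (w x ds : List ℕ) (inp : ℕ → ℕ) : Prop where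
  w_len : inp 0 = w.length
  w_at : ∀ c (h : c < w.length), inp (1 + c) = w[c]
  x_len : inp (w.length + 1) = x.length
  x_at : ∀ c (h : c < x.length), inp (w.length + 2 + c) = x[c]
  ds_len : inp (w.length + x.length + 2) = ds.length
  ds_at : ∀ c (h : c < ds.length), inp (w.length + x.length + 3 + c) = ds[c]

theorem pairsOutput_length (L : List (ℕ × ℕ)) : (pairsOutput L).length = 2 * L.length := by
  induction L with
  | nil => rfl
  | cons q L ih =>
    simp only [pairsOutput, List.flatMap_cons, List.length_append, List.length_cons] at ih ⊢
    rw [ih]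
    simp
    ring

theorem pairsOutput_concat (L : List (ℕ × ℕ)) (q : ℕ × ℕ) :
    pairsOutput (L ++ [q]) = pairsOutput L ++ [q.1, q.2] := by
  simp [pairsOutput]

/-- After the first `t` pairs have been tested, the output consists of the matches among them. -/
def OutputState (w x : List ℕ) (k t : ℕ) (τ : St Var) : Prop :=
  ∃ L : List (ℕ × ℕ), L.Nodup ∧ L.length ≤ t ∧
    (∀ q, q ∈ L ↔ q.2 ≤ w.length ∧ q.1 * (w.length + 1) + q.2 < t ∧ IsBinomMatch w x k q) ∧
    τ.var .out = (pairsOutput L).length ∧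
    ∀ i, i < (pairsOutput L).length → (pairsOutput L)[i]? = some (τ.mem 1 i)

theorem OutputState.next_of_not {w x : List ℕ} {k t : ℕ} {τ τ' : St Var}
    (h : OutputState w x k t τ) (ho : τ'.var .out = τ.var .out) (hm : τ'.mem 1 = τ.mem 1)
    (hq : ¬ IsBinomMatch w x k (t / (w.length + 1), t % (w.length + 1))) :
    OutputState w x k (t + 1) τ' := by
  obtain ⟨L, h1, h2, h3, h4, h5⟩ := h
  refine ⟨L, h1, by omega, fun q => (h3 q).trans ?_, ho.trans h4, hm ▸ h5⟩
  refine ⟨fun ⟨a, b, c⟩ => ⟨a, by omega, c⟩, fun ⟨a, b, c⟩ => ⟨a, ?_, c⟩⟩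
  refine lt_of_le_of_ne (by omega) fun heq => hq ?_
  have e1 : t / (w.length + 1) = q.1 := by
    rw [← heq, mul_comm, Nat.mul_add_div (by omega), Nat.div_eq_of_lt (by omega), add_zero]
  have e2 : t % (w.length + 1) = q.2 := by
    rw [← heq, mul_comm, Nat.mul_add_mod, Nat.mod_eq_of_lt (by omega)]
  rw [e1, e2]
  exact c

theorem OutputState.next {w x : List ℕ} {k t : ℕ} {τ τ' : St Var}
    (h : OutputState w x k t τ) (ho : τ'.var .out = τ.var .out + 2)
    (hm : ∀ i < τ.var .out, τ'.mem 1 i = τ.mem 1 i)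
    (hm0 : τ'.mem 1 (τ.var .out) = t / (w.length + 1))
    (hm1 : τ'.mem 1 (τ.var .out + 1) = t % (w.length + 1))
    (hq : IsBinomMatch w x k (t / (w.length + 1), t % (w.length + 1))) :
    OutputState w x k (t + 1) τ' := by
  obtain ⟨L, h1, h2, h3, h4, h5⟩ := h
  have hdm := Nat.div_add_mod t (w.length + 1)
  have hml : t % (w.length + 1) ≤ w.length := Nat.le_of_lt_succ (Nat.mod_lt _ (by omega))
  rw [mul_comm] at hdm
  refine ⟨L ++ [(t / (w.length + 1), t % (w.length + 1))], ?_, by simpa using h2,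
    fun q => ?_, ?_, fun i hi => ?_⟩
  · rw [List.nodup_append]
    refine ⟨h1, List.nodup_singleton _, fun a ha b hb hab => ?_⟩
    rw [List.mem_singleton] at hb
    subst hb
    subst hab
    have := ((h3 _).1 ha).2.1
    simp only at this
    omega
  · rw [List.mem_append, List.mem_singleton, h3 q]
    constructor
    · rintro (⟨a, b, c⟩ | rfl)
      · exact ⟨a, by omega, c⟩
      · exact ⟨hml, by simp only; omega, hq⟩
    · rintro ⟨a, b, c⟩
      rcases Nat.lt_or_ge (q.1 * (w.length + 1) + q.2) t with hlt | hge
      · exact Or.inl ⟨a, hlt, c⟩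
      · have heq : q.1 * (w.length + 1) + q.2 = t := by omega
        refine Or.inr (Prod.ext ?_ ?_)
        · simp only
          rw [← heq, mul_comm, Nat.mul_add_div (by omega), Nat.div_eq_of_lt (by omega), add_zero]
        · simp only
          rw [← heq, mul_comm, Nat.mul_add_mod, Nat.mod_eq_of_lt (by omega)]
  · rw [ho, h4, pairsOutput_concat]; simp
  · rw [pairsOutput_concat] at hi ⊢
    simp only [List.length_append, List.length_cons, List.length_nil, zero_add] at hi
    rw [h4] at hm hm0 hm1
    rcases Nat.lt_or_ge i (pairsOutput L).length with hlt | hge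
    · rw [List.getElem?_append_left hlt, hm i hlt, h5 i hlt]
    · rw [List.getElem?_append_right hge]
      obtain rfl | rfl : i = (pairsOutput L).length ∨ i = (pairsOutput L).length + 1 := by omega
      · simp [hm0]
      · simp [hm1]

theorem wp_matchCmd {M N : ℕ} (hB : Bounds M (N ^ 4) N) {inp : ℕ → ℕ} {w x : List ℕ} {k : ℕ}
    (hinp : IsInput w x (Nat.digits 2 k) inp)
    (hN : N = w.length + x.length + (Nat.digits 2 k).length + 3) {σ : St Var}
    (hσ : σ.mem 0 = inp) :
    matchCmd.wp M (N ^ 4) (OutputState w x k ((w.length + 1) * (w.length + 1))) σ := by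
  have hlin := hB.lin
  have hND := hB.le_dim
  have hN3 := hB.three_le
  generalize hds : Nat.digits 2 k = ds at hinp hN
  refine ⟨?_, ?_, ?_, ?_, ?_, ?_⟩
  · simp only [Ex.Ok, Ex.eval]
    and_intros <;> omega
  · simp [hσ, hinp.w_len]
    and_intros <;> omega
  · simp [hσ, hinp.w_len, hinp.x_len]
    and_intros <;> omega
  · simp [hσ, hinp.w_len, hinp.x_len, hinp.ds_len]
    and_intros <;> omega
  · simp only [Ex.Ok]; omega
  refine Cmd.wp_of_eq fun σ₁ hσ₁ => ?_
  have a1 : σ₁.var .n = w.length := by rw [hσ₁]; simp [hσ, hinp.w_len]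
  have a2 : σ₁.var .lx = x.length := by rw [hσ₁]; simp [hσ, hinp.w_len, hinp.x_len]
  have a3 : σ₁.var .kb = ds.length := by
    rw [hσ₁]; simp [hσ, hinp.w_len, hinp.x_len, hinp.ds_len]
  have a4 : σ₁.var .N = N := by rw [hσ₁, hN]; simp [hσ, hinp.w_len, hinp.x_len, hinp.ds_len]
  have a5 : σ₁.var .k = 0 := by rw [hσ₁]; simp
  have a6 : σ₁.mem 0 = inp := by rw [hσ₁]; exact hσ
  clear hσ₁
  have hbit : ∀ c (h : c < ds.length), ds[c] < 2 := fun c h => by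
    subst hds
    exact Nat.digits_lt_base (by norm_num) (List.getElem_mem h)
  refine Cmd.wp_loop (fun j τ => τ.mem 0 = inp ∧
      τ.var .k = min (Nat.ofDigits 2 (ds.drop (ds.length - j))) N) (by decide) (by decide)
    (by decide) (by omega) ⟨a6, by rw [a5]; simp⟩ ?_ ?_
  · rintro j τ hj hfr ⟨h1, h2⟩
    rw [a3] at hj
    have f1 : τ.var .N = N := by rw [hfr .N (by decide), a4]
    have hidx : N - 1 - j = w.length + x.length + 3 + (ds.length - (j + 1)) := by omega
    have hb := hbit (ds.length - (j + 1)) (by omega)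
    have hval : inp (N - 1 - j) = ds[ds.length - (j + 1)] := by
      rw [hidx]; exact hinp.ds_at _ _
    have hk : τ.var .k ≤ N := by rw [h2]; exact min_le_right _ _
    have hdrop : Nat.ofDigits 2 (ds.drop (ds.length - (j + 1))) =
        ds[ds.length - (j + 1)] + 2 * Nat.ofDigits 2 (ds.drop (ds.length - j)) := by
      rw [List.drop_eq_getElem_cons (by omega), Nat.ofDigits_cons]
      congr 4
      omega
    refine ⟨?_, ?_, fun hlt => ⟨trivial, h1, ?_⟩, fun hge => ⟨h1, ?_⟩⟩
    · simp [f1, h1, hval]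
      and_intros <;> omega
    · simp
    · simp [f1, h1, hval] at hlt ⊢
      rw [hdrop]; omega
    · simp [f1, h1, hval] at hge ⊢
      rw [hdrop]; omega
  · rintro τ hfr ⟨h1, h2⟩
    rw [a3, Nat.sub_self, List.drop_zero, ← hds, Nat.ofDigits_digits] at h2
    have b1 : τ.var .n = w.length := by rw [hfr .n (by decide), a1]
    have b2 : τ.var .lx = x.length := by rw [hfr .lx (by decide), a2]
    have b3 : τ.var .N = N := by rw [hfr .N (by decide), a4]
    have hnn : (w.length + 1) * (w.length + 1) ≤ N * N := Nat.mul_le_mul (by omega) (by omega)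
    refine ⟨by simp only [Ex.Ok]; omega, ?_, ?_⟩
    · simp [b1]; omega
    refine Cmd.wp_of_eq fun σ₂ hσ₂ => ?_
    have c1 : σ₂.var .n = w.length := by rw [hσ₂]; simp [b1]
    have c2 : σ₂.var .lx = x.length := by rw [hσ₂]; simp [b2]
    have c3 : σ₂.var .N = N := by rw [hσ₂]; simp [b3]
    have c4 : σ₂.var .k = min k N := by rw [hσ₂]; simp [h2]
    have c5 : σ₂.var .nn = (w.length + 1) * (w.length + 1) := by rw [hσ₂]; simp [b1]
    have c6 : σ₂.var .out = 0 := by rw [hσ₂]; simp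
    have c7 : σ₂.mem 0 = inp := by rw [hσ₂]; exact h1
    clear hσ₂
    refine Cmd.wp_loop (fun t τ => τ.mem 0 = inp ∧ OutputState w x k t τ) (by decide) (by decide)
      (by decide) (by omega) ⟨c7, [], List.nodup_nil, by simp, by simp, by simp [c6, pairsOutput],
        by simp [pairsOutput]⟩ ?_ ?_
    · rintro t τ₁ ht hfr₁ ⟨g1, g2⟩
      rw [c5] at ht
      have d1 : τ₁.var .n = w.length := by rw [hfr₁ .n (by decide), c1]
      refine ⟨?_, ?_, ?_⟩
      · simp [d1]; omega
      · simp [d1]; omega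
      refine Cmd.wp_of_eq fun τ₂ hτ₂ => ?_
      have e1 : τ₂.var .i = t / (w.length + 1) := by rw [hτ₂]; simp [d1]
      have e2 : τ₂.var .l = t % (w.length + 1) := by rw [hτ₂]; simp [d1]
      have e3 : ∀ z, z ∉ [Var.i, .l, .t] → τ₂.var z = τ₁.var z := fun z hz => by
        simp only [List.mem_cons, List.not_mem_nil, or_false, not_or] at hz
        rw [hτ₂]; simp [hz]
      have e4 : τ₂.mem = τ₁.mem := by rw [hτ₂]; rfl
      clear hτ₂
      have e5 : τ₂.var .n = w.length := by rw [e3 .n (by decide), d1]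
      have e6 : t / (w.length + 1) < w.length + 1 := Nat.div_lt_of_lt_mul ht
      have e7 : t % (w.length + 1) < w.length + 1 := Nat.mod_lt _ (by omega)
      set i := t / (w.length + 1) with hi
      set l := t % (w.length + 1) with hl
      refine ⟨?_, fun hne => ?_, fun h0 => ?_⟩
      · simp [e1, e2, e5]; and_intros <;> omega
      · replace hne : i + l < w.length + 1 := by simpa [e1, e2, e5] using hne
        set u := (w.drop i).take l with hu
        have hul : u.length = l := by rw [hu]; simp; omega
        refine wp_testCmd hB (inp := inp) (u := u) (x := x) (k := min k N) ?_ ?_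
        · have hv : ∀ z ∈ [Var.n, .lx, .N, .k],
              (τ₂.set .d (u.length + x.length + 2)).var z = σ₂.var z := fun z hz => by
            rw [St.var_set, if_neg (by rintro rfl; revert hz; decide),
              e3 z (by revert z; decide), hfr₁ z (by revert z; decide)]
          have v1 := (hv .n (by decide)).trans c1
          have v2 : (τ₂.set .d (u.length + x.length + 2)).var .i = i := by simp [e1]
          refine ⟨by rw [St.mem_set, e4, g1], by simp [e2, hul],
            (hv .lx (by decide)).trans c2, by simp,
            (hv .N (by decide)).trans c3, (hv .k (by decide)).trans c4,
            min_le_right _ _, ?_, ?_, fun c hc => ?_, fun c hc => ?_⟩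
          · rw [v1, v2]; omega
          · rw [v1]; omega
          · rw [v2, add_assoc, hinp.w_at _ (by omega)]
            simp [hu]
          · rw [v1]; exact hinp.x_at c hc
        · intro τ₃ k1 k2 k3
          have hmatch : τ₃.var .bad = 0 ↔ IsBinomMatch w x k (i, l) := by
            rw [k3, binomEquiv_min (by omega) (by omega)]
            exact ⟨fun h => ⟨by simp only; omega, h⟩, fun h => h.2⟩
          have l1 : τ₃.var .out = τ₁.var .out := by rw [k1 .out (by decide), e3 .out (by decide)]
          have l2 : τ₃.mem 1 = τ₁.mem 1 := by rw [k2 1 (by omega), e4]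
          have l3 : τ₃.mem 0 = inp := by rw [k2 0 (by omega), e4, g1]
          have l4 : τ₃.var .i = i := by rw [k1 .i (by decide), e1]
          have l5 : τ₃.var .l = l := by rw [k1 .l (by decide), e2]
          refine ⟨trivial, fun hb => ⟨l3, g2.next_of_not l1 l2 fun h => hb (hmatch.2 h)⟩,
            fun hb => ?_⟩
          have hout : τ₁.var .out + 2 ≤ N * N + N * N := by
            obtain ⟨L, -, hL, -, ho, -⟩ := g2
            rw [ho, pairsOutput_length]; omega
          refine ⟨?_, trivial, ?_, trivial, ?_, ?_, g2.next (t := t) ?_ (fun c hc => ?_) ?_ ?_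
            (hmatch.1 hb)⟩
          · simp [l1]; and_intros <;> omega
          · simp [l1]; and_intros <;> omega
          · simp [l1]; and_intros <;> omega
          · simp only [St.mem_set]
            rw [St.mem_write_row _ _ _ (by simp), St.mem_write_row _ _ _ (by simp), l3]
          · simp [l1]
          · simp only [St.mem_set, St.var_write, Ex.eval, BinOp.natEval, BinOp.eval, l1]
            rw [St.mem_write, if_neg (by omega), St.mem_write, if_neg (by omega), l2]
          · simp [l1, St.mem_write, l4, hi]
          · simp [l1, St.mem_write, l5, hl]
      · replace h0 : w.length + 1 ≤ i + l := by simpa [e1, e2, e5] using h0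
        refine ⟨by rw [e4, g1], g2.next_of_not (e3 .out (by decide)) (by rw [e4]) fun h => ?_⟩
        have := h.1
        simp only at this
        omega
    · rintro τ₁ hfr₁ ⟨g1, g2⟩
      rw [c5] at g2
      exact g2

/-- Code that computes the fourth power of the length of the input in register `0`. -/
def preludeCode : List Instr :=
  [.load 27 27, .const 28 1, .op .add 27 27 28, .load 29 27, .op .add 27 27 29, .op .add 27 27 28,
    .load 29 27, .op .add 27 27 29, .op .add 27 27 28, .op .mul 0 27 27, .op .mul 0 0 0]

/-- The matching program. -/
def matchProgram : Program :=
  preludeCode ++ matchCmd.compile Var.idx 27 11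

theorem codeAt_append_right (L L' : List Instr) : CodeAt (L ++ L') L.length L' := by
  intro i hi
  rw [List.getElem?_append_right (by omega)]
  simp [hi]

theorem prelude_spec {W N : ℕ} {w x ds input : List ℕ}
    (hinp : IsInput w x ds fun i => input.getD i 0)
    (hN : N = w.length + x.length + ds.length + 3) (hW : N ^ 4 < 2 ^ W) :
    ∃ c, Reaches W matchProgram 11 (init input) c ∧ c.pc = 11 ∧ c.reg 0 = N ^ 4 ∧
      c.mem = (init input).mem ∧ ∀ x : Var, c.reg x.idx = 0 := by
  have hget : ∀ i, input[i]?.getD 0 = input.getD i 0 := fun i => List.getD_eq_getElem?_getD.symm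
  have h0 : input[0]?.getD 0 = w.length := (hget 0).trans hinp.w_len
  have h1 : input[w.length + 1]?.getD 0 = x.length := (hget _).trans hinp.x_len
  have h2 : input[w.length + 1 + x.length + 1]?.getD 0 = ds.length := by
    rw [show w.length + 1 + x.length + 1 = w.length + x.length + 2 by omega]
    exact (hget _).trans hinp.ds_len
  have hN1 : N ≤ N ^ 4 := Nat.le_self_pow (by norm_num) N
  have e1 : 1 % 2 ^ W = 1 := Nat.mod_eq_of_lt (by omega)
  have e2 : (w.length + 1) % 2 ^ W = w.length + 1 := Nat.mod_eq_of_lt (by omega)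
  have e3 : (w.length + 1 + x.length + 1) % 2 ^ W = w.length + 1 + x.length + 1 :=
    Nat.mod_eq_of_lt (by omega)
  have e4 : w.length + 1 + x.length + 1 + ds.length + 1 = N := by omega
  have e5 : N * N * (N * N) % 2 ^ W = N ^ 4 := by
    rw [show N * N * (N * N) = N ^ 4 by ring]; exact Nat.mod_eq_of_lt hW
  refine ⟨_, ⟨11, le_rfl, rfl⟩, ?_⟩
  simp only [Function.iterate_succ, Function.iterate_zero, Function.comp_apply, id_eq]
  simp [step, matchProgram, preludeCode, Instr.exec, Config.setReg, init, BinOp.eval,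
    Function.update_apply, h0, h1, h2, e1, e2, e3, e4, e5]
  intro y
  have hy := Var.idx_isLayout.lt y
  have hy' := Var.idx_isLayout.pos y
  simp [hy'.ne', hy.ne, show y.idx ≠ 28 by omega, show y.idx ≠ 29 by omega]

theorem isInput_matchInput {A : Type} (code : A → ℕ) (w x : List A) (k : ℕ) :
    IsInput (w.map code) (x.map code) (Nat.digits 2 k)
      fun i => (matchInput code w x k).getD i 0 := by
  have key : ∀ (a b c : List ℕ), IsInput a b c
      fun i => ((a.length :: a) ++ (b.length :: b) ++ (c.length :: c)).getD i 0 := by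
    intro a b c
    have hA : (a.length :: a).length = a.length + 1 := rfl
    have hAB : (a.length :: a ++ b.length :: b).length = a.length + b.length + 2 := by
      simp; omega
    refine ⟨by simp, fun i hi => ?_, ?_, fun i hi => ?_, ?_, fun i hi => ?_⟩ <;>
      simp only [List.getD_eq_getElem?_getD]
    · rw [List.append_assoc, List.getElem?_append_left (by omega), add_comm, List.getElem?_cons_succ,
        List.getElem?_eq_getElem hi, Option.getD_some]
    · rw [List.append_assoc, List.getElem?_append_right (by omega), hA, Nat.sub_self]
      simp
    · rw [List.append_assoc, List.getElem?_append_right (by omega), hA,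
        show a.length + 2 + i - (a.length + 1) = i + 1 by omega, List.cons_append,
        List.getElem?_cons_succ, List.getElem?_append_left hi, List.getElem?_eq_getElem hi,
        Option.getD_some]
    · rw [List.getElem?_append_right (by omega), hAB, Nat.sub_self]
      simp
    · rw [List.getElem?_append_right (by omega), hAB,
        show a.length + b.length + 3 + i - (a.length + b.length + 2) = i + 1 by omega,
        List.getElem?_cons_succ, List.getElem?_eq_getElem hi, Option.getD_some]
  have h := key (w.map code) (x.map code) (Nat.digits 2 k)
  simpa only [matchInput, List.length_map] using h

theorem bounds_of_pow_le {M N : ℕ} (hN : 3 ≤ N) (h : N ^ 12 ≤ M) : Bounds M (N ^ 4) N := by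
  have h2 : 3 * N ≤ N * N := Nat.mul_le_mul_right N hN
  have h4 : 9 * (N * N) ≤ N ^ 4 := by
    rw [show N ^ 4 = (N * N) * (N * N) by ring]
    exact Nat.mul_le_mul_right _ (by omega)
  have h12 : N ^ 12 = N ^ 4 * N ^ 4 * N ^ 4 := by ring
  set D := N ^ 4 with hD
  have h5 : 81 ≤ D := by omega
  have h6 : 81 * (D * D) ≤ D * D * D := by
    rw [mul_comm]; exact Nat.mul_le_mul_left _ h5
  have h7 : 81 * D ≤ D * D := Nat.mul_le_mul_right _ h5
  refine ⟨hN, by omega, ?_, ?_⟩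
  · have : (2 * N + 5) * D ≤ D * D := Nat.mul_le_mul_right _ (by omega)
    omega
  · have : 3 * (D + 2) * (D + 2) = 3 * (D * D) + 12 * D + 12 := by ring
    omega

theorem isBinomMatch_map {A B : Type} [DecidableEq A] [DecidableEq B] {f : A → B}
    (hf : Function.Injective f) (w x : List A) (k : ℕ) (q : ℕ × ℕ) :
    IsBinomMatch (w.map f) (x.map f) k q ↔ IsBinomMatch w x k q := by
  rw [IsBinomMatch, IsBinomMatch, List.length_map, ← List.map_drop, ← List.map_take,
    binomEquiv_map hf]

theorem matchInput_length {A : Type} (code : A → ℕ) (w x : List A) (k : ℕ) :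
    (matchInput code w x k).length =
      w.length + x.length + (Nat.digits 2 k).length + 3 := by
  simp [matchInput]; omega

theorem matchInput_lt {A : Type} {code : A → ℕ} {W : ℕ} (hcode : ∀ a, code a < 2 ^ W)
    (w x : List A) (k : ℕ) (hN : (matchInput code w x k).length ≤ 2 ^ W) (i : ℕ) :
    (matchInput code w x k).getD i 0 < 2 ^ W := by
  have hlen := matchInput_length code w x k
  have hmem : ∀ a ∈ matchInput code w x k, a < 2 ^ W := by
    intro a ha
    simp only [matchInput, List.mem_append, List.mem_cons, List.mem_map] at ha
    rcases ha with ((rfl | ⟨b, -, rfl⟩) | (rfl | ⟨b, -, rfl⟩)) | (rfl | hd)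
    · omega
    · exact hcode b
    · omega
    · exact hcode b
    · omega
    · have := Nat.digits_lt_base (by norm_num) hd
      omega
  rcases Nat.lt_or_ge i (matchInput code w x k).length with hi | hi
  · rw [List.getD_eq_getElem _ _ hi]
    exact hmem _ (List.getElem_mem hi)
  · rw [List.getD_eq_default _ _ hi]
    positivity

end WordRAM

/-- Pattern matching under `k`-binomial equivalence in polynomial time. -/
theorem theorem3 :
    ∃ (P : WordRAM.Program) (p : Polynomial ℕ) (C : ℕ), 0 < C ∧
      ∀ (A : Type) [DecidableEq A] (W : ℕ) (code : A → ℕ),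
        Function.Injective code → (∀ a, code a < 2 ^ W) →
        ∀ (w x : List A) (k : ℕ),
          (matchInput code w x k).length ^ C ≤ 2 ^ W →
          ∃ L : List (ℕ × ℕ),
            L.Nodup ∧ (∀ q, q ∈ L ↔ IsBinomMatch w x k q) ∧
            WordRAM.ComputesWithin W P (matchInput code w x k)
              (p.eval (matchInput code w x k).length) (pairsOutput L) := by
  open WordRAM in
  refine ⟨matchProgram, 11 + (matchCmd.time Var.idx 27).comp (Polynomial.X ^ 4), 12, by norm_num, ?_⟩
  intro A _ W code hinj hcode w x k hW
  have hinp := isInput_matchInput code w x k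
  have hlen := matchInput_length code w x k
  have hlt := matchInput_lt (W := W) hcode w x k
  set input := matchInput code w x k with hinput
  set N := input.length with hN
  have hN3 : 3 ≤ N := by omega
  have hB := bounds_of_pow_le hN3 hW
  have hlin := hB.lin
  have hdim := hB.le_dim
  have hW0 : 0 < W := Nat.pos_of_ne_zero fun h => by subst h; simp at hlin
  obtain ⟨c, hc, hpc, hr0, hmem, hvar⟩ := prelude_spec (W := W) hinp (N := N) (by simpa using hlen)
    (by omega)
  have hrel : Rel Var.idx W (N ^ 4) ⟨fun _ => 0, fun i j => input.getD (i * N ^ 4 + j) 0⟩ c :=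
    ⟨hr0, by omega, hvar, fun _ => by positivity, fun i j _ => by rw [hmem]; rfl,
      fun i j _ => hlt (by omega) _⟩
  have hcode : CodeAt matchProgram c.pc (matchCmd.compile Var.idx 27 c.pc) := by
    rw [hpc]; exact codeAt_append_right preludeCode _
  obtain ⟨c', σ', hc', hpc', hrel', L, h1, h2, h3, h4, h5⟩ :=
    Cmd.compile_spec Var.idx_isLayout (by norm_num) hW0
      (wp_matchCmd hB hinp (by simpa using hlen) (by simp)) hrel hcode
  rw [List.length_map] at h2 h3
  have hLlen : (pairsOutput L).length ≤ N ^ 4 := by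
    have : (w.length + 1) * (w.length + 1) ≤ N * N := Nat.mul_le_mul (by omega) (by omega)
    rw [pairsOutput_length]; omega
  obtain ⟨t, ht, rfl⟩ := (hc.trans hc').mono
    (T' := (11 + (matchCmd.time Var.idx 27).comp (Polynomial.X ^ 4)).eval N) (by simp)
  refine ⟨L, h1, fun q => ?_, t, ht, ?_, ?_, ?_, fun i hi => ?_⟩
  · rw [h3, isBinomMatch_map hinj]
    refine ⟨fun h => h.2.2, fun h => ⟨by have := h.1; omega, ?_, h⟩⟩
    have hq := h.1
    have : q.1 * (w.length + 1) ≤ w.length * (w.length + 1) :=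
      Nat.mul_le_mul_right _ (by omega)
    have e : (w.length + 1) * (w.length + 1) = w.length * (w.length + 1) + (w.length + 1) := by ring
    omega
  · rw [Halted, hpc', hpc]
    simp [matchProgram, preludeCode]
    omega
  · rw [← h4, ← hrel'.var]; rfl
  · rw [hrel'.dim]; omega
  · have := h5 i hi
    rw [List.getElem?_eq_getElem hi] at this
    have hm := hrel'.mem 1 i (by omega)
    rw [one_mul] at hm
    rw [hrel'.dim, hm]
    exact (Option.some.inj this).symm
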